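/- **Setting.** Let $m\ge 1$ and let $F_1,\dots,F_m$ be probability distributions on Polish spaces. All asymptotics are along a sequence of data sizes $(n_1,\dots,n_m)$ with all $n_i\to\infty$; $n=\frac1m\sum_i n_i$. For each $i$ one has i.i.d. data $X_{i,1},\dots,X_{i,n_i}\sim F_i$, independent over $i$, with empirical distribution $\widehat F_i$. Let $\mathcal P_i$ be the convex hull of $F_i$ and of the Dirac measures at the points of the support of $F_i$. Let $\psi$ be a real function on $\prod_i\mathcal P_i$ that is simulable: for $P\in\prod_i\mathcal P_i$ one can draw independent replications $\hat\psi_r(P)$ with mean $\psi(P)$; let $\tau^2(P)$ and $\mu_4(P)$ be their variance and fourth central moment. The input variance is $\sigma_I^2=\mathrm{Var}[\psi(\widehat F_1,\dots,\widehat F_m)]$. Given $\theta\in(0,1]$, let $s_i=\lfloor\theta n_i\rfloor$, $s=\frac1m\sum_i s_i$, and let $\widehat F^*_{s_i,i}$ be the empirical distribution of $s_i$ points drawn uniformly with replacement from $X_{i,1},\dots,X_{i,n_i}$, independently over $i$; $\mathbb E_*$ is the expectation over this resampling given the data. **Algorithm** (parameters $B,R\ge2$, $\theta$). For $b=1,\dots,B$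 independently draw $\widehat F^{b}_{s_i,i}$, $i=1,\dots,m$, as above, and, given these, $R$ independent replications $\hat\psi^b_r=\hat\psi_r(\widehat F^b_{s_1,1},\dots,\widehat F^b_{s_m,m})$. With $\bar\psi^b=\frac1R\sum_r\hat\psi_r^b$, $\bar{\bar\psi}=\frac1B\sum_b\bar\psi^b$ and $V=\frac1{B(R-1)}\sum_{b,r}(\hat\psi^b_r-\bar\psi^b)^2$, output $$\hat\sigma_{SVB}^2=\theta\Big(\frac1{B-1}\sum_{b=1}^B(\bar\psi^b-\bar{\bar\psi})^2-\frac VR\Big).$$ **Assumptions.** 1. $\max_i n_i/\min_i n_i\le c$ for some finite $c$. 2. For $P\in\prod_i\mathcal P_i$ there are influence functions $g_i(P;\cdot)$ with $\mathbb E_{P_i}[g_i(P;X_i)]=0$ such that for $Q\in\prod_i\mathcal P_i$ and $P_i^{\nu_i}=(1-\nu_i)P_i+\nu_iQ_i$, as $\nu\to0$ in $[0,1]^m$, $$\psi(P_1^{\nu_1},\dots,P_m^{\nu_m})-\psi(P)=\sum_i\nu_i\int g_i(P;x)\,d(Q_i-P_i)(x)+o\Big(\sqrt{\textstyle\sum_i\nu_i^2}\Big).$$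 3. With $g_i=g_i(F_1,\dots,F_m;\cdot)$, the remainder $\epsilon=\psi(\widehat F_1,\dots,\widehat F_m)-\psi(F_1,\dots,F_m)-\sum_i\int g_i\,d(\widehat F_i-F_i)$ has $\mathbb E[\epsilon^2]=o(n^{-1})$; $\mathrm{Var}_{F_i}[g_i(X_i)]>0$ and $\mathbb E_{F_i}[g_i^4(X_i)]<\infty$ for all $i$. 4. With $\hat g_i=g_i(\widehat F_1,\dots,\widehat F_m;\cdot)$, $\mathbb E[(\hat g_i-g_i)^4(X_{i,1})]\to0$ for all $i$; and for every $(\overline F_1,\dots,\overline F_m)\in\prod_i\{\widehat F_i,\widehat F^*_{s_i,i}\}$ the remainder $\epsilon^*=\psi(\overline F_1,\dots,\overline F_m)-\psi(\widehat F_1,\dots,\widehat F_m)-\sum_i\int\hat g_i\,d(\overline F_i-\widehat F_i)$ has $\mathbb E_*[(\epsilon^*)^4]=o_p(s^{-2})$. 5. $\tau^2(\widehat F_1,\dots,\widehat F_m)\to\tau^2(F_1,\dots,F_m)<\infty$ in probability. 6. $\mathbb E_*[(\tau^2(\overline F_1,\dots,\overline F_m)-\tau^2(\widehat F_1,\dots,\widehat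 F_m))^2]=o_p(1)$ for every $(\overline F_i)_i$ as in 4. 7. $\mathbb E_*[\mu_4(\overline F_1,\dots,\overline F_m)]=O_p(1)$ for every $(\overline F_i)_i$ as in 4. **Theorem 4.** Let the above assumptions hold. Let $N$ be a total simulation budget (a natural number depending on the data sizes) with $N\to\infty$, and let the subsample ratio $\theta\in(0,1]$ satisfy $\theta n\to\infty$ and $\theta n/N\to0$ (that is, $\omega(1/n)\le\theta\le o(N/n)\wedge1$). Then there are integers $B,R\ge2$ (depending on the data sizes) with $BR\le N$ eventually, $BR/N\to1$, and $$B\to\infty,\qquad \frac{BR^2}{(\theta n)^2}\to\infty,\qquad \theta n\to\infty. \tag{$*$}$$ Moreover, for every choice of integers $B,R\ge 2$ that satisfies $(*)$, the output is relatively consistent: $\hat\sigma_{SVB}^2/\sigma_I^2\to1$ in probability. -/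

import Mathlib

open MeasureTheory ProbabilityTheory Filter Topology Asymptotics
open scoped ENNReal NNReal

noncomputable section

namespace InputVariance

/-! ### Input models, empirical distributions, simulation -/

/-- The empirical distribution `(1/n) ∑ⱼ δ_{xⱼ}` of a sample of size `n`. -/
def empirical {α : Type*} [MeasurableSpace α] {n : ℕ} (x : Fin n → α) : Measure α :=
  (n : ℝ≥0∞)⁻¹ • ∑ j, Measure.dirac (x j)

/-- The convex hull of `F` and of all Dirac measures at points of the support of `F`. -/
def admissible {α : Type*} [TopologicalSpace α] [MeasurableSpace α] (F : Measure α) :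
    Set (Measure α) :=
  {P | ∃ (l : ℕ) (w₀ : ℝ≥0) (w : Fin l → ℝ≥0) (x : Fin l → α),
    (∀ k, x k ∈ F.support) ∧ w₀ + ∑ k, w k = 1 ∧
      P = w₀ • F + ∑ k, w k • Measure.dirac (x k)}

/-- `(1 - ν) P + ν Q` -/
def mix {α : Type*} [MeasurableSpace α] (P Q : Measure α) (ν : ℝ) : Measure α :=
  ENNReal.ofReal (1 - ν) • P + ENNReal.ofReal ν • Q

/-- The average `(1/m) ∑ᵢ nᵢ` of a family of sizes. -/
def avg {ι : Type*} [Fintype ι] (n : ι → ℕ) : ℝ :=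
  (∑ i, (n i : ℝ)) / Fintype.card ι

/-- The subsample sizes `sᵢ = ⌊θ nᵢ⌋`. -/
def subSize {ι : Type*} (θ : ℝ) (n : ι → ℕ) (i : ι) : ℕ := ⌊θ * n i⌋₊

/-- The data set that consists of the first `nᵢ` observations of each input model. -/
def sample {ι Ω : Type*} {𝒳 : ι → Type*} (X : ∀ i, ℕ → Ω → 𝒳 i) (n : ι → ℕ) (ω : Ω) :
    ∀ i, Fin (n i) → 𝒳 i :=
  fun i j => X i j ω

/-- The family of empirical distributions of a data set. -/
def empiricals {ι : Type*} {𝒳 : ι → Type*} [∀ i, MeasurableSpace (𝒳 i)] {n : ι → ℕ}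
    (x : ∀ i, Fin (n i) → 𝒳 i) : ∀ i, Measure (𝒳 i) :=
  fun i => empirical (x i)

/-- Indices of a resample of sizes `s` from a data set of sizes `n`. -/
abbrev Draw {ι : Type*} (n s : ι → ℕ) : Type _ := ∀ i, Fin (s i) → Fin (n i)

/-- Uniform sampling with replacement, independent over the input models. -/
def drawLaw {ι : Type*} (n s : ι → ℕ) : Measure (Draw n s) := uniformOn Set.univ

/-- The resampled data set. -/
def resample {ι : Type*} {𝒳 : ι → Type*} {n s : ι → ℕ} (x : ∀ i, Fin (n i) → 𝒳 i)
    (J : Draw n s) : ∀ i, Fin (s i) → 𝒳 i :=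
  fun i l => x i (J i l)

/-- The family whose `i`-th member is the resampled empirical distribution if `A i` holds and the
original empirical distribution otherwise. -/
def mixedModels {ι : Type*} {𝒳 : ι → Type*} [∀ i, MeasurableSpace (𝒳 i)] {n s : ι → ℕ}
    (x : ∀ i, Fin (n i) → 𝒳 i) (J : Draw n s) (A : ι → Bool) : ∀ i, Measure (𝒳 i) :=
  fun i => if A i then empiricals (resample x J) i else empiricals x i

/-- `ψ` is simulable: when the simulation is driven by admissible input models `P`, a replication
has a probability law `law P` on `ℝ` with mean `ψ P`. -/
def Simulable {ι : Type*} {𝒳 : ι → Type*} [∀ i, TopologicalSpace (𝒳 i)]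
    [∀ i, MeasurableSpace (𝒳 i)] (F : ∀ i, Measure (𝒳 i))
    (ψ : (∀ i, Measure (𝒳 i)) → ℝ) (law : (∀ i, Measure (𝒳 i)) → Measure ℝ) : Prop :=
  ∀ P : ∀ i, Measure (𝒳 i), (∀ i, P i ∈ admissible (F i)) →
    IsProbabilityMeasure (law P) ∧ Integrable (fun y : ℝ => y) (law P) ∧ ∫ y, y ∂(law P) = ψ P

/-- Measurability of the simulation law and of the influence functions along empirical
distributions, as functions of the sample points. -/
def MeasurableInSample {ι : Type*} {𝒳 : ι → Type*} [∀ i, MeasurableSpace (𝒳 i)]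
    (law : (∀ i, Measure (𝒳 i)) → Measure ℝ)
    (g : (∀ i, Measure (𝒳 i)) → ∀ i, 𝒳 i → ℝ) : Prop :=
  ∀ s : ι → ℕ,
    Measurable (fun x : (∀ i, Fin (s i) → 𝒳 i) => law (empiricals x)) ∧
    ∀ (i : ι) (j : Fin (s i)),
      Measurable (fun x : (∀ i, Fin (s i) → 𝒳 i) => g (empiricals x) i (x i j))

/-- The variance `τ²(P)` of a simulation replication driven by `P`. -/
def tauSq {ι : Type*} {𝒳 : ι → Type*} [∀ i, MeasurableSpace (𝒳 i)]
    (ψ : (∀ i, Measure (𝒳 i)) → ℝ) (law : (∀ i, Measure (𝒳 i)) → Measure ℝ)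
    (P : ∀ i, Measure (𝒳 i)) : ℝ :=
  ∫ y, (y - ψ P) ^ 2 ∂(law P)

/-- The fourth central moment `μ₄(P)` of a simulation replication driven by `P`. -/
def mu4 {ι : Type*} {𝒳 : ι → Type*} [∀ i, MeasurableSpace (𝒳 i)]
    (ψ : (∀ i, Measure (𝒳 i)) → ℝ) (law : (∀ i, Measure (𝒳 i)) → Measure ℝ)
    (P : ∀ i, Measure (𝒳 i)) : ℝ≥0∞ :=
  ∫⁻ y, ENNReal.ofReal ((y - ψ P) ^ 4) ∂(law P)

/-! ### Regularity assumptions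

The asymptotic regime is a sequence of data sizes `n k i`, where `k` is the index of the sequence
and `i` that of the input model. -/

/-- Balanced data: the sizes grow to infinity and their ratios stay bounded. -/
def BalancedData {ι : Type*} (n : ℕ → ι → ℕ) : Prop :=
  (∀ i, Tendsto (fun k => n k i) atTop atTop) ∧
    ∃ c : ℝ, 0 < c ∧ ∀ᶠ k in atTop, ∀ i j, (n k i : ℝ) ≤ c * n k j

/-- First order (Gateaux) differentiability on the admissible input models, with influence
functions `g P i`. -/
def FirstOrderDifferentiable {ι : Type*} [Fintype ι] {𝒳 : ι → Type*}
    [∀ i, TopologicalSpace (𝒳 i)] [∀ i, MeasurableSpace (𝒳 i)] (F : ∀ i, Measure (𝒳 i))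
    (ψ : (∀ i, Measure (𝒳 i)) → ℝ) (g : (∀ i, Measure (𝒳 i)) → ∀ i, 𝒳 i → ℝ) : Prop :=
  ∀ P : ∀ i, Measure (𝒳 i), (∀ i, P i ∈ admissible (F i)) →
    (∀ i, ∀ Q ∈ admissible (F i), Integrable (g P i) Q) ∧
    (∀ i, ∫ x, g P i x ∂(P i) = 0) ∧
    ∀ Q : ∀ i, Measure (𝒳 i), (∀ i, Q i ∈ admissible (F i)) →
      (fun ν : ι → ℝ => ψ (fun i => mix (P i) (Q i) (ν i)) - ψ P
          - ∑ i, ν i * (∫ x, g P i x ∂(Q i) - ∫ x, g P i x ∂(P i)))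
        =o[𝓝[Set.Icc 0 1] 0] fun ν : ι → ℝ => Real.sqrt (∑ i, ν i ^ 2)

/-- The remainder of the first order expansion of `ψ` from `P` to `Q`. -/
def remainder {ι : Type*} [Fintype ι] {𝒳 : ι → Type*} [∀ i, MeasurableSpace (𝒳 i)]
    (ψ : (∀ i, Measure (𝒳 i)) → ℝ) (g : (∀ i, Measure (𝒳 i)) → ∀ i, 𝒳 i → ℝ)
    (P Q : ∀ i, Measure (𝒳 i)) : ℝ :=
  ψ Q - ψ P - ∑ i, (∫ x, g P i x ∂(Q i) - ∫ x, g P i x ∂(P i))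

/-- Smoothness at the true input models: the remainder satisfies `E[ε²] = o(1/n)`, and the
influence functions have positive variance and a finite fourth moment. -/
def SmoothAtTruth {ι Ω : Type*} [Fintype ι] [MeasurableSpace Ω] {𝒳 : ι → Type*}
    [∀ i, MeasurableSpace (𝒳 i)] (μ : Measure Ω) (X : ∀ i, ℕ → Ω → 𝒳 i)
    (F : ∀ i, Measure (𝒳 i)) (ψ : (∀ i, Measure (𝒳 i)) → ℝ)
    (g : (∀ i, Measure (𝒳 i)) → ∀ i, 𝒳 i → ℝ) (n : ℕ → ι → ℕ) : Prop :=
  Tendsto (fun k => ENNReal.ofReal (avg (n k)) *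
      ∫⁻ ω, ENNReal.ofReal (remainder ψ g F (empiricals (sample X (n k) ω)) ^ 2) ∂μ)
    atTop (𝓝 0) ∧
  ∀ i, 0 < Var[g F i; F i] ∧ MemLp (g F i) 4 (F i)

/-- Smoothness at the empirical input models: the empirical influence functions converge in
fourth moment, and for every choice of the models that are resampled the remainder satisfies
`E_*[(ε*)⁴] = o_p(s⁻²)`. -/
def SmoothAtEmpirical {ι Ω : Type*} [Fintype ι] [MeasurableSpace Ω] {𝒳 : ι → Type*}
    [∀ i, MeasurableSpace (𝒳 i)] (μ : Measure Ω) (X : ∀ i, ℕ → Ω → 𝒳 i)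
    (F : ∀ i, Measure (𝒳 i)) (ψ : (∀ i, Measure (𝒳 i)) → ℝ)
    (g : (∀ i, Measure (𝒳 i)) → ∀ i, 𝒳 i → ℝ) (n : ℕ → ι → ℕ) (θ : ℕ → ℝ) : Prop :=
  (∀ i, Tendsto (fun k => ∫⁻ ω, ENNReal.ofReal
      ((g (empiricals (sample X (n k) ω)) i (X i 0 ω) - g F i (X i 0 ω)) ^ 4) ∂μ)
    atTop (𝓝 0)) ∧
  ∀ A : ι → Bool, TendstoInMeasure μ
    (fun k ω => avg (subSize (θ k) (n k)) ^ 2 *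
      ∫ J, remainder ψ g (empiricals (sample X (n k) ω))
        (mixedModels (sample X (n k) ω) J A) ^ 4 ∂(drawLaw (n k) (subSize (θ k) (n k))))
    atTop (fun _ => (0 : ℝ))

/-- Convergence in probability of the simulation variance at the empirical input models to the
(finite) simulation variance at the true ones. -/
def EmpiricalVarianceConverges {ι Ω : Type*} [MeasurableSpace Ω] {𝒳 : ι → Type*}
    [∀ i, MeasurableSpace (𝒳 i)] (μ : Measure Ω) (X : ∀ i, ℕ → Ω → 𝒳 i)
    (F : ∀ i, Measure (𝒳 i)) (ψ : (∀ i, Measure (𝒳 i)) → ℝ)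
    (law : (∀ i, Measure (𝒳 i)) → Measure ℝ) (n : ℕ → ι → ℕ) : Prop :=
  Integrable (fun y : ℝ => (y - ψ F) ^ 2) (law F) ∧
  TendstoInMeasure μ (fun k ω => tauSq ψ law (empiricals (sample X (n k) ω)))
    atTop (fun _ => tauSq ψ law F)

/-- Convergence of the resampled simulation variance:
`E_*[(τ²(F̄₁, …, F̄ₘ) - τ²(F̂₁, …, F̂ₘ))²] = o_p(1)` for every choice of the resampled models. -/
def ResampledVarianceConverges {ι Ω : Type*} [Fintype ι] [MeasurableSpace Ω] {𝒳 : ι → Type*}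
    [∀ i, MeasurableSpace (𝒳 i)] (μ : Measure Ω) (X : ∀ i, ℕ → Ω → 𝒳 i)
    (ψ : (∀ i, Measure (𝒳 i)) → ℝ) (law : (∀ i, Measure (𝒳 i)) → Measure ℝ)
    (n : ℕ → ι → ℕ) (θ : ℕ → ℝ) : Prop :=
  ∀ A : ι → Bool, TendstoInMeasure μ
    (fun k ω => ∫ J, (tauSq ψ law (mixedModels (sample X (n k) ω) J A)
        - tauSq ψ law (empiricals (sample X (n k) ω))) ^ 2
      ∂(drawLaw (n k) (subSize (θ k) (n k))))
    atTop (fun _ => (0 : ℝ))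

/-- `E_*[μ₄(F̄₁, …, F̄ₘ)] = O_p(1)` for every choice of the resampled models. -/
def FourthMomentBounded {ι Ω : Type*} [Fintype ι] [MeasurableSpace Ω] {𝒳 : ι → Type*}
    [∀ i, MeasurableSpace (𝒳 i)] (μ : Measure Ω) (X : ∀ i, ℕ → Ω → 𝒳 i)
    (ψ : (∀ i, Measure (𝒳 i)) → ℝ) (law : (∀ i, Measure (𝒳 i)) → Measure ℝ)
    (n : ℕ → ι → ℕ) (θ : ℕ → ℝ) : Prop :=
  ∀ A : ι → Bool, ∀ ε : ℝ≥0∞, 0 < ε → ∃ M : ℝ≥0, ∀ᶠ k in atTop,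
    μ {ω | (M : ℝ≥0∞) < ∫⁻ J, mu4 ψ law (mixedModels (sample X (n k) ω) J A)
      ∂(drawLaw (n k) (subSize (θ k) (n k)))} ≤ ε

/-! ### The subsampled variance bootstrap -/

/-- The input variance `σ_I² = Var[ψ(F̂₁, …, F̂ₘ)]` for data sizes `n`. -/
def inputVar {ι Ω : Type*} [MeasurableSpace Ω] {𝒳 : ι → Type*}
    [∀ i, MeasurableSpace (𝒳 i)] (μ : Measure Ω) (X : ∀ i, ℕ → Ω → 𝒳 i)
    (ψ : (∀ i, Measure (𝒳 i)) → ℝ) (n : ι → ℕ) : ℝ :=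
  Var[fun ω => ψ (empiricals (sample X n ω)); μ]

/-- The average of the replications of one group. -/
def groupMean {R : ℕ} (y : Fin R → ℝ) : ℝ := (∑ r, y r) / R

/-- The estimate computed from the array `y b r` of simulation replications: `θ` times the
difference of the between-group sample variance and `V / R`, where `V` is the pooled within-group
sample variance. -/
def svbEstimate (θ : ℝ) {B R : ℕ} (y : Fin B → Fin R → ℝ) : ℝ :=
  θ * ((∑ b, (groupMean (y b) - (∑ b', groupMean (y b')) / B) ^ 2) / (B - 1)
    - (∑ b, ∑ r, (y b r - groupMean (y b)) ^ 2) / (B * (R - 1)) / R)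

/-- The law of the array of simulation replications given the data `x`: for each of the `B`
independent groups one draws subsamples of sizes `⌊θ nᵢ⌋`, and then, given the subsamples, `R`
independent replications driven by their empirical distributions. -/
def replicationLaw {ι : Type*} {𝒳 : ι → Type*} [∀ i, MeasurableSpace (𝒳 i)]
    (law : (∀ i, Measure (𝒳 i)) → Measure ℝ) (θ : ℝ) (B R : ℕ) {n : ι → ℕ}
    (x : ∀ i, Fin (n i) → 𝒳 i) : Measure (Fin B → Fin R → ℝ) :=
  Measure.pi fun _ : Fin B =>
    (drawLaw n (subSize θ n)).bind fun J =>
      Measure.pi fun _ : Fin R => law (empiricals (resample x J))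

/-- The law of the output of the proportionate subsampled variance bootstrap, given the data. -/
def svbLaw {ι : Type*} {𝒳 : ι → Type*} [∀ i, MeasurableSpace (𝒳 i)]
    (law : (∀ i, Measure (𝒳 i)) → Measure ℝ) (θ : ℝ) (B R : ℕ) {n : ι → ℕ}
    (x : ∀ i, Fin (n i) → 𝒳 i) : Measure ℝ :=
  (replicationLaw law θ B R x).map (svbEstimate θ)

/-- Relative consistency: the ratio of the output of the algorithm and `σ_I²` converges to `1` in
probability, under the joint law of the data, the resampling and the simulation. -/
def RelativelyConsistent {ι Ω : Type*} [MeasurableSpace Ω] {𝒳 : ι → Type*}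
    [∀ i, MeasurableSpace (𝒳 i)] (μ : Measure Ω) (X : ∀ i, ℕ → Ω → 𝒳 i)
    (ψ : (∀ i, Measure (𝒳 i)) → ℝ) (law : (∀ i, Measure (𝒳 i)) → Measure ℝ)
    (n : ℕ → ι → ℕ) (θ : ℕ → ℝ) (B R : ℕ → ℕ) : Prop :=
  ∀ ε : ℝ, 0 < ε → Tendsto
    (fun k => ∫⁻ ω, svbLaw law (θ k) (B k) (R k) (sample X (n k) ω)
      {v | ε ≤ |v / inputVar μ X ψ (n k) - 1|} ∂μ)
    atTop (𝓝 0)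

/-- The criterion `B = ω(1)`, `B R² = ω((θ n)²)`, `θ = ω(1/n)`. -/
def Criterion {ι : Type*} [Fintype ι] (n : ℕ → ι → ℕ) (θ : ℕ → ℝ) (B R : ℕ → ℕ) : Prop :=
  Tendsto B atTop atTop ∧
  Tendsto (fun k => (B k : ℝ) * (R k : ℝ) ^ 2 / (θ k * avg (n k)) ^ 2) atTop atTop ∧
  Tendsto (fun k => θ k * avg (n k)) atTop atTop

end InputVariance

end

namespace InputVariance

/-! ### Moments -/

/-! Write a = θ n, the order of the subsample sizes. Given the data, the groups of replications are
i.i.d., and the law of a group is a mixture of product laws over the finitely many resampling draws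
(`groupLaw`). By the law of total variance a group mean has variance v + E_*[τ²]/R with v =
Var_*[ψ(F̂*)], while V has mean E_*[τ²]. So the output is conditionally unbiased for θ v, and its
error splits in two.

Fluctuation: the mean square error of a sample variance of B copies is at most a constant times the
fourth central moment over B. For group means this moment is O(a⁻² + E_*[μ₄]/R²), and the correction
V/R adds O(E_*[μ₄]/(B R²)). Relative to v², which is of order a⁻², this gives 1/B + a²/(B R²),
exactly what the criterion sends to zero (`integral_svbEstimate_sub_sq_le`).

Bias: to first order v is ∑ Var_{F̂ᵢ}(ĝᵢ)/sᵢ (`abs_variance_draw_sub_le`) and σ_I² is ∑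
Var_{Fᵢ}(gᵢ)/nᵢ (`tendsto_inputVar_sub`). Exchangeability reduces ĝᵢ to gᵢ on the sample, the law of
large numbers treats gᵢ (`tendsto_influenceMoment_two`), and a/sᵢ − n/nᵢ is a rounding error. Since
the influence functions have positive variance, σ_I² is of exact order 1/n, so θ v/σ_I² → 1 in
probability.

Chebyshev's inequality given the data (`map_svbEstimate_le`) bounds the conditional failure
probability by a quantity that vanishes in probability, and bounded convergence integrates this over
the data. Convergence in probability is convergence along the filter `inProb`, so the ordinary
calculus of limits applies, without measurability of the conditional bounds.

For the allocation, R is near √(N a) and B near N/R (`exists_allocation`). -/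

lemma add_pow_four_le (a b : ℝ) : (a + b) ^ 4 ≤ 8 * (a ^ 4 + b ^ 4) := by
  nlinarith [sq_nonneg (a - b), sq_nonneg (a ^ 2 - b ^ 2), sq_nonneg (a + b),
    sq_nonneg ((a - b) * (a + b)), sq_nonneg ((a - b) ^ 2),
    mul_nonneg (sq_nonneg (a - b)) (sq_nonneg a), mul_nonneg (sq_nonneg (a - b)) (sq_nonneg b)]

section Moments

variable {Ω : Type*} [MeasurableSpace Ω] {μ : Measure Ω}

lemma memLp_four_iff {f : Ω → ℝ} (hf : AEStronglyMeasurable f μ) :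
    MemLp f 4 μ ↔ Integrable (fun x => f x ^ 4) μ := by
  rw [← integrable_norm_rpow_iff hf (by norm_num) (by norm_num)]
  refine iff_of_eq (congrArg (fun h => Integrable h μ) (funext fun x => ?_))
  have h : (4 : ℝ≥0∞).toReal = ((4 : ℕ) : ℝ) := by norm_num
  rw [h, Real.rpow_natCast, Real.norm_eq_abs]
  exact Even.pow_abs (by decide) _

lemma integrable_pow_four {f : Ω → ℝ} (hf : MemLp f 4 μ) : Integrable (fun x => f x ^ 4) μ :=
  (memLp_four_iff hf.1).1 hf

lemma memLp_two_of_four [IsFiniteMeasure μ] {f : Ω → ℝ} (hf : MemLp f 4 μ) : MemLp f 2 μ :=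
  hf.mono_exponent (by norm_num)

lemma integrable_of_four [IsFiniteMeasure μ] {f : Ω → ℝ} (hf : MemLp f 4 μ) : Integrable f μ :=
  hf.integrable (by norm_num)

lemma integrable_sq_of_four [IsFiniteMeasure μ] {f : Ω → ℝ} (hf : MemLp f 4 μ) :
    Integrable (fun x => f x ^ 2) μ :=
  (memLp_two_of_four hf).integrable_sq

lemma memLp_sq_of_four {f : Ω → ℝ} (hf : MemLp f 4 μ) :
    MemLp (fun x => f x ^ 2) 2 μ := by
  refine (memLp_two_iff_integrable_sq (hf.1.pow 2)).2 ?_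
  refine (integrable_pow_four hf).congr (ae_of_all _ fun x => ?_)
  simp only [Pi.pow_apply]
  ring

lemma integrable_cube_of_four [IsFiniteMeasure μ] {f : Ω → ℝ} (hf : MemLp f 4 μ) :
    Integrable (fun x => f x ^ 3) μ := by
  refine ((integrable_pow_four hf).add (integrable_sq_of_four hf)).mono' (hf.1.pow 3)
    (ae_of_all _ fun x => ?_)
  simp only [Pi.add_apply, Real.norm_eq_abs]
  rw [abs_le]
  -- The domination is |t|³ ≤ t⁴ + t².
  constructor <;> nlinarith [sq_nonneg (f x * (f x - 1)), sq_nonneg (f x * (f x + 1)),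
    sq_nonneg (f x), sq_nonneg (f x ^ 2)]

lemma integrable_mul_of_two {f g : Ω → ℝ} (hf : MemLp f 2 μ) (hg : MemLp g 2 μ) :
    Integrable (fun x => f x * g x) μ :=
  hf.integrable_mul hg

lemma sq_integral_le [IsProbabilityMeasure μ] {f : Ω → ℝ} (hf : MemLp f 2 μ) :
    (∫ x, f x ∂μ) ^ 2 ≤ ∫ x, f x ^ 2 ∂μ := by
  have h := variance_nonneg f μ
  rw [variance_eq_sub hf] at h
  simpa using h

lemma pow_four_integral_le [IsProbabilityMeasure μ] {f : Ω → ℝ} (hf : MemLp f 4 μ) :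
    (∫ x, f x ∂μ) ^ 4 ≤ ∫ x, f x ^ 4 ∂μ := by
  have h1 := sq_integral_le (memLp_two_of_four hf)
  have h2 := sq_integral_le (memLp_sq_of_four hf)
  calc (∫ x, f x ∂μ) ^ 4 = ((∫ x, f x ∂μ) ^ 2) ^ 2 := by ring
    _ ≤ (∫ x, f x ^ 2 ∂μ) ^ 2 := by gcongr
    _ ≤ ∫ x, (f x ^ 2) ^ 2 ∂μ := h2
    _ = _ := by congr 1; ext x; ring

lemma integral_sq_le_sqrt [IsProbabilityMeasure μ] {f : Ω → ℝ} (hf : MemLp f 4 μ) :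
    ∫ x, f x ^ 2 ∂μ ≤ √(∫ x, f x ^ 4 ∂μ) := by
  apply Real.le_sqrt_of_sq_le
  refine (sq_integral_le (memLp_sq_of_four hf)).trans_eq ?_
  congr 1; ext x; ring

/-- Centring at the mean costs at most a factor `16` in the fourth moment. -/
lemma integral_sub_mean_pow_four_le [IsProbabilityMeasure μ] {f : Ω → ℝ} (hf : MemLp f 4 μ)
    (c : ℝ) : ∫ x, (f x - ∫ y, f y ∂μ) ^ 4 ∂μ ≤ 16 * ∫ x, (f x - c) ^ 4 ∂μ := by
  have hc : MemLp (fun x => f x - c) 4 μ := hf.sub (memLp_const c)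
  have hm : ∫ y, f y ∂μ - c = ∫ x, (f x - c) ∂μ := by
    rw [integral_sub (integrable_of_four hf) (integrable_const c)]; simp
  -- Jensen bounds the shift of the centre by the fourth moment about `c`; the factor is 16 = 8 + 8.
  have h1 := pow_four_integral_le hc
  rw [← hm] at h1
  have h2 : ∫ x, (f x - ∫ y, f y ∂μ) ^ 4 ∂μ
      ≤ ∫ x, (8 * (f x - c) ^ 4 + 8 * (∫ y, f y ∂μ - c) ^ 4) ∂μ := by
    refine integral_mono (integrable_pow_four (hf.sub (memLp_const _)))
      (((integrable_pow_four hc).const_mul 8).add (integrable_const _)) fun x => ?_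
    simp only
    have h := add_pow_four_le (f x - c) (-(∫ y, f y ∂μ - c))
    rw [Even.neg_pow (by decide)] at h
    calc _ = (f x - c + -(∫ y, f y ∂μ - c)) ^ 4 := by ring
      _ ≤ _ := by linarith
  rw [integral_add ((integrable_pow_four hc).const_mul 8) (integrable_const _),
    integral_const_mul] at h2
  simp at h2
  linarith

end Moments

/-! ### Sums of independent variables and perturbation of the variance -/

section IndependentSums

variable {Ω ι : Type*} [MeasurableSpace Ω] {μ : Measure Ω} [IsProbabilityMeasure μ]

/-- In the binomial expansion the terms S³Z and SZ³ integrate to zero, because each contains a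
centred factor to the first power. -/
lemma integral_add_pow_four_of_indepFun {S Z : Ω → ℝ} (h : IndepFun S Z μ) (hS : MemLp S 4 μ)
    (hZ : MemLp Z 4 μ) (hS0 : ∫ ω, S ω ∂μ = 0) (hZ0 : ∫ ω, Z ω ∂μ = 0) :
    ∫ ω, (S ω + Z ω) ^ 4 ∂μ = ∫ ω, S ω ^ 4 ∂μ
      + 6 * ((∫ ω, S ω ^ 2 ∂μ) * ∫ ω, Z ω ^ 2 ∂μ) + ∫ ω, Z ω ^ 4 ∂μ := by
  have e (p q : ℕ) : IndepFun (fun ω => S ω ^ p) (fun ω => Z ω ^ q) μ :=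
    h.comp (measurable_id.pow_const p) (measurable_id.pow_const q)
  have hm (p q : ℕ) : ∫ ω, S ω ^ p * Z ω ^ q ∂μ = (∫ ω, S ω ^ p ∂μ) * ∫ ω, Z ω ^ q ∂μ :=
    (e p q).integral_fun_mul_eq_mul_integral (hS.1.pow p) (hZ.1.pow q)
  have i31 : Integrable (fun ω => S ω ^ 3 * Z ω ^ 1) μ :=
    (e 3 1).integrable_mul (integrable_cube_of_four hS) (by simpa using integrable_of_four hZ)
  have i22 : Integrable (fun ω => S ω ^ 2 * Z ω ^ 2) μ :=
    (e 2 2).integrable_mul (integrable_sq_of_four hS) (integrable_sq_of_four hZ)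
  have i13 : Integrable (fun ω => S ω ^ 1 * Z ω ^ 3) μ :=
    (e 1 3).integrable_mul (by simpa using integrable_of_four hS) (integrable_cube_of_four hZ)
  have hexp : ∀ ω, (S ω + Z ω) ^ 4 = (S ω ^ 4 + 4 * (S ω ^ 3 * Z ω ^ 1)
      + 6 * (S ω ^ 2 * Z ω ^ 2)) + (4 * (S ω ^ 1 * Z ω ^ 3) + Z ω ^ 4) := fun ω => by ring
  have j1 : Integrable (fun ω => S ω ^ 4 + 4 * (S ω ^ 3 * Z ω ^ 1)) μ :=
    (integrable_pow_four hS).add (i31.const_mul 4)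
  have j2 : Integrable (fun ω => S ω ^ 4 + 4 * (S ω ^ 3 * Z ω ^ 1)
      + 6 * (S ω ^ 2 * Z ω ^ 2)) μ := j1.add (i22.const_mul 6)
  have j3 : Integrable (fun ω => 4 * (S ω ^ 1 * Z ω ^ 3) + Z ω ^ 4) μ :=
    (i13.const_mul 4).add (integrable_pow_four hZ)
  simp_rw [hexp]
  rw [integral_add j2 j3, integral_add j1 (i22.const_mul 6),
    integral_add (integrable_pow_four hS) (i31.const_mul 4),
    integral_add (i13.const_mul 4) (integrable_pow_four hZ), integral_const_mul,
    integral_const_mul, integral_const_mul, hm, hm, hm]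
  simp [hS0, hZ0]

/-- The fourth moment of a sum of independent centred random variables. -/
lemma integral_sum_pow_four_le {Z : ι → Ω → ℝ} (hind : iIndepFun Z μ) (hZ : ∀ i, MemLp (Z i) 4 μ)
    (h0 : ∀ i, ∫ ω, Z i ω ∂μ = 0) {K : ℝ} (hK : ∀ i, ∫ ω, Z i ω ^ 4 ∂μ ≤ K) (s : Finset ι) :
    ∫ ω, (∑ i ∈ s, Z i ω) ^ 2 ∂μ = ∑ i ∈ s, ∫ ω, Z i ω ^ 2 ∂μ ∧
      ∫ ω, (∑ i ∈ s, Z i ω) ^ 4 ∂μ ≤ 3 * (s.card : ℝ) ^ 2 * K := by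
  classical
  -- The second moment is carried along because the cross term 6 E[S²] E[Z²] needs it.
  induction s using Finset.induction_on with
  | empty => simp
  | insert a s ha ih =>
    have hS : MemLp (fun ω => ∑ i ∈ s, Z i ω) 4 μ := memLp_finsetSum s fun i _ => hZ i
    have hS0 : ∫ ω, ∑ i ∈ s, Z i ω ∂μ = 0 := by
      rw [integral_finsetSum _ fun i _ => integrable_of_four (hZ i)]
      exact Finset.sum_eq_zero fun i _ => h0 i
    have hi : IndepFun (fun ω => ∑ i ∈ s, Z i ω) (Z a) μ := by
      have := hind.indepFun_finsetSum_of_notMem₀ (fun i => (hZ i).1.aemeasurable) ha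
      convert this using 1
      ext ω; simp
    have hK0 : 0 ≤ K := (integral_nonneg fun ω => by positivity).trans (hK a)
    have hsq (i : ι) : ∫ ω, Z i ω ^ 2 ∂μ ≤ √K :=
      (integral_sq_le_sqrt (hZ i)).trans (Real.sqrt_le_sqrt (hK i))
    have h2 : ∑ i ∈ s, ∫ ω, Z i ω ^ 2 ∂μ ≤ s.card * √K := by
      simpa using Finset.sum_le_card_nsmul s _ _ fun i _ => hsq i
    simp_rw [Finset.sum_insert ha, Finset.card_insert_of_notMem ha, add_comm (Z a _)]
    constructor
    · have hm := hi.integral_fun_mul_eq_mul_integral hS.1 (hZ a).1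
      have j1 := integrable_sq_of_four hS
      have j2 := (integrable_mul_of_two (memLp_two_of_four hS) (memLp_two_of_four (hZ a))).const_mul 2
      have hexp : ∀ ω, (∑ i ∈ s, Z i ω + Z a ω) ^ 2 = (∑ i ∈ s, Z i ω) ^ 2
          + 2 * ((∑ i ∈ s, Z i ω) * Z a ω) + Z a ω ^ 2 := fun ω => by ring
      have j3 : Integrable (fun ω => (∑ i ∈ s, Z i ω) ^ 2 + 2 * ((∑ i ∈ s, Z i ω) * Z a ω)) μ :=
        j1.add j2
      simp_rw [hexp]
      rw [integral_add j3 (integrable_sq_of_four (hZ a)), integral_add j1 j2,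
        integral_const_mul, hm, h0, ih.1]
      ring
    · rw [integral_add_pow_four_of_indepFun hi hS (hZ a) hS0 (h0 a), ih.1]
      have h3 : (∑ i ∈ s, ∫ ω, Z i ω ^ 2 ∂μ) * ∫ ω, Z a ω ^ 2 ∂μ ≤ (s.card * √K) * √K :=
        mul_le_mul h2 (hsq a) (integral_nonneg fun ω => by positivity) (by positivity)
      rw [mul_assoc, Real.mul_self_sqrt hK0] at h3
      have := ih.2
      have := hK a
      push_cast
      -- With k the old cardinality: 3k²K + 6kK + K ≤ 3(k + 1)²K.
      nlinarith

/-- The variance is stable under perturbations that are small in mean square. -/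
lemma abs_variance_add_sub_le {f h : Ω → ℝ} (hf : MemLp f 2 μ) (hh : MemLp h 2 μ) :
    |Var[fun ω => f ω + h ω; μ] - Var[f; μ]|
      ≤ ∫ ω, h ω ^ 2 ∂μ + 2 * √(Var[f; μ] * ∫ ω, h ω ^ 2 ∂μ) := by
  rw [variance_fun_add hf hh]
  have h1 : Var[h; μ] ≤ ∫ ω, h ω ^ 2 ∂μ := variance_le_expectation_sq hh.1
  have h0 := variance_nonneg h μ
  have h2 : cov[f, h; μ] ^ 2 ≤ Var[f; μ] * Var[h; μ] := by
    -- Cauchy–Schwarz for the covariance: the quadratic t ↦ Var[t f + h] is nonnegative, so its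
    -- discriminant is not positive.
    have key : ∀ t : ℝ, 0 ≤ Var[f; μ] * (t * t) + (2 * cov[f, h; μ]) * t + Var[h; μ] := fun t => by
      have h3 := variance_nonneg (fun ω => t * f ω + h ω) μ
      rw [variance_fun_add (hf.const_mul t) hh, variance_const_mul, covariance_const_mul_left] at h3
      linarith
    have := discrim_le_zero key
    unfold discrim at this
    linarith
  have h4 : |cov[f, h; μ]| ≤ √(Var[f; μ] * ∫ ω, h ω ^ 2 ∂μ) := by
    apply Real.abs_le_sqrt
    exact h2.trans (mul_le_mul_of_nonneg_left h1 (variance_nonneg f μ))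
  rw [abs_le] at h4 ⊢
  constructor <;> linarith [h4.1, h4.2]

end IndependentSums

/-! ### Convergence in probability as convergence along a filter -/

section InProbability

variable {Ω : Type*} [MeasurableSpace Ω]

/-- The sets of pairs `(k, ω)` that contain `(k, ω)` with (outer) probability tending to one. -/
def inProb (μ : Measure Ω) : Filter (ℕ × Ω) where
  sets := {S | Tendsto (fun k => μ {ω | (k, ω) ∉ S}) atTop (𝓝 0)}
  univ_sets := by simp
  sets_of_superset {S T} hS hST :=
    tendsto_of_tendsto_of_tendsto_of_le_of_le tendsto_const_nhds hS (fun _ => zero_le)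
      fun _ => measure_mono fun _ hω h => hω (hST h)
  inter_sets {S T} hS hT := by
    have h := Tendsto.add (show Tendsto _ _ _ from hS) (show Tendsto _ _ _ from hT)
    rw [add_zero] at h
    refine tendsto_of_tendsto_of_tendsto_of_le_of_le tendsto_const_nhds h (fun _ => zero_le)
      fun k => ?_
    refine (measure_mono fun ω hω => ?_).trans (measure_union_le _ _)
    by_contra hc
    simp only [Set.mem_union, Set.mem_ofPred_eq, not_or, not_not] at hc
    exact hω ⟨hc.1, hc.2⟩

variable {μ : Measure Ω}

lemma eventually_inProb {p : ℕ × Ω → Prop} :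
    (∀ᶠ q in inProb μ, p q) ↔ Tendsto (fun k => μ {ω | ¬ p (k, ω)}) atTop (𝓝 0) := Iff.rfl

lemma tendsto_fst_inProb : Tendsto Prod.fst (inProb μ) atTop := by
  intro S hS
  change Tendsto (fun k => μ {ω | (k, ω) ∉ Prod.fst ⁻¹' S}) atTop (𝓝 0)
  refine tendsto_const_nhds.congr' ?_
  filter_upwards [hS] with k hk
  simp [hk]

lemma eventually_inProb_of_ae {p : ℕ × Ω → Prop} (h : ∀ᵐ ω ∂μ, ∀ k, p (k, ω)) :
    ∀ᶠ q in inProb μ, p q := by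
  rw [eventually_inProb]
  refine tendsto_const_nhds.congr fun k => ?_
  symm
  exact ae_iff.1 (h.mono fun ω hω => hω k)

/-- Gives access to sums, products, square roots and squeezing for limits in probability. -/
lemma tendsto_inProb_iff {f : ℕ → Ω → ℝ} {c : ℝ} :
    Tendsto (fun q : ℕ × Ω => f q.1 q.2) (inProb μ) (𝓝 c) ↔
      TendstoInMeasure μ f atTop fun _ => c := by
  rw [tendstoInMeasure_iff_dist, Metric.tendsto_nhds]
  refine forall₂_congr fun ε _ => ?_
  rw [eventually_inProb]
  simp only [not_lt]

/-- Markov's inequality. -/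
lemma tendsto_inProb_of_lintegral {f : ℕ → Ω → ℝ} (hf : ∀ᶠ k in atTop, AEMeasurable (f k) μ)
    (h : Tendsto (fun k => ∫⁻ ω, ENNReal.ofReal (f k ω) ∂μ) atTop (𝓝 0))
    (h0 : ∀ k ω, 0 ≤ f k ω) :
    Tendsto (fun q : ℕ × Ω => f q.1 q.2) (inProb μ) (𝓝 0) := by
  rw [tendsto_inProb_iff, tendstoInMeasure_iff_dist]
  intro ε hε
  have h' := ENNReal.Tendsto.div_const h (b := ENNReal.ofReal ε) (Or.inr (by simpa using hε))
  rw [ENNReal.zero_div] at h'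
  refine tendsto_of_tendsto_of_tendsto_of_le_of_le' tendsto_const_nhds h'
    (Eventually.of_forall fun _ => zero_le) ?_
  filter_upwards [hf] with k hk
  have hm := mul_meas_ge_le_lintegral₀ (hk.ennreal_ofReal) (ENNReal.ofReal ε)
  rw [ENNReal.le_div_iff_mul_le (Or.inl (by simpa using hε)) (Or.inl (by simp)), mul_comm]
  refine le_trans ?_ hm
  gcongr with ω
  intro hω
  rw [dist_zero_right, Real.norm_eq_abs, abs_of_nonneg (h0 k ω)] at hω
  exact ENNReal.ofReal_le_ofReal hω

/-- A sequence that is bounded in probability times a vanishing sequence of numbers. -/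
lemma tendsto_inProb_of_bounded {a : ℕ → ℝ} (ha : Tendsto a atTop (𝓝 0)) {f : ℕ → Ω → ℝ≥0∞}
    (hf : ∀ ε : ℝ≥0∞, 0 < ε → ∃ M : ℝ≥0, ∀ᶠ k in atTop, μ {ω | (M : ℝ≥0∞) < f k ω} ≤ ε) :
    Tendsto (fun q : ℕ × Ω => a q.1 * (f q.1 q.2).toReal) (inProb μ) (𝓝 0) := by
  rw [tendsto_inProb_iff (f := fun k ω => a k * (f k ω).toReal), tendstoInMeasure_iff_dist]
  intro δ hδ
  rw [ENNReal.tendsto_nhds_zero]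
  intro ε hε
  obtain ⟨M, hM⟩ := hf ε hε
  have ha' : ∀ᶠ k in atTop, |a k| * (M + 1) < δ := by
    have : Tendsto (fun k => |a k| * (M + 1)) atTop (𝓝 0) := by
      simpa using (ha.abs.mul_const ((M : ℝ) + 1))
    exact this.eventually_lt_const hδ
  filter_upwards [hM, ha'] with k hk hak
  refine (measure_mono fun ω hω => ?_).trans hk
  simp only [Set.mem_ofPred_eq, dist_zero_right, Real.norm_eq_abs, abs_mul, ENNReal.abs_toReal] at hω ⊢
  by_contra hc
  rw [not_lt] at hc
  have h1 : (f k ω).toReal ≤ M := ENNReal.toReal_le_coe_of_le_coe hc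
  have : |a k| * (f k ω).toReal ≤ |a k| * (M + 1) := by
    gcongr; linarith
  linarith

/-- The value ∞ exceeds every bound `M`. This complements `tendsto_inProb_of_bounded`, where
`toReal` would hide infinite values. -/
lemma eventually_inProb_ne_top {f : ℕ → Ω → ℝ≥0∞}
    (hf : ∀ ε : ℝ≥0∞, 0 < ε → ∃ M : ℝ≥0, ∀ᶠ k in atTop, μ {ω | (M : ℝ≥0∞) < f k ω} ≤ ε) :
    ∀ᶠ q in inProb μ, f q.1 q.2 ≠ ∞ := by
  rw [eventually_inProb, ENNReal.tendsto_nhds_zero]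
  intro ε hε
  obtain ⟨M, hM⟩ := hf ε hε
  filter_upwards [hM] with k hk
  refine (measure_mono fun ω hω => ?_).trans hk
  simp only [ne_eq, not_not, Set.mem_ofPred_eq] at hω ⊢
  simp [hω]

/-- Bounded convergence, without measurability. -/
lemma tendsto_lintegral_of_inProb [IsProbabilityMeasure μ] {f : ℕ → Ω → ℝ≥0∞}
    (h1 : ∀ᶠ k in atTop, ∀ᵐ ω ∂μ, f k ω ≤ 1)
    (h : ∀ δ : ℝ, 0 < δ → ∀ᶠ q in inProb μ, f q.1 q.2 ≤ ENNReal.ofReal δ) :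
    Tendsto (fun k => ∫⁻ ω, f k ω ∂μ) atTop (𝓝 0) := by
  rw [ENNReal.tendsto_nhds_zero]
  intro ε hε
  obtain ⟨δ, hδ, hδε⟩ : ∃ δ : ℝ, 0 < δ ∧ ENNReal.ofReal δ ≤ ε / 2 := by
    have hε2 : (0 : ℝ≥0∞) < ε / 2 := ENNReal.half_pos hε.ne'
    obtain ⟨r, hr0, hr⟩ := ENNReal.lt_iff_exists_nnreal_btwn.1 hε2
    exact ⟨r, by simpa using hr0, by simpa using hr.le⟩
  have h2 := eventually_inProb.1 (h δ hδ)
  have h3 := (ENNReal.tendsto_nhds_zero.1 h2) (ε / 2) (ENNReal.half_pos hε.ne')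
  filter_upwards [h1, h3] with k hk1 hk3
  -- The bad event need not be measurable; its measurable hull has the same mass and can be
  -- integrated.
  set E := toMeasurable μ {ω | ¬ f k ω ≤ ENNReal.ofReal δ} with hE
  calc ∫⁻ ω, f k ω ∂μ ≤ ∫⁻ ω, (E.indicator 1 ω + ENNReal.ofReal δ) ∂μ := by
        refine lintegral_mono_ae ?_
        filter_upwards [hk1] with ω hω
        by_cases hc : f k ω ≤ ENNReal.ofReal δ
        · exact hc.trans le_add_self
        · have : ω ∈ E := subset_toMeasurable _ _ hc
          simp only [Set.indicator_of_mem this, Pi.one_apply]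
          exact hω.trans le_self_add
    _ = μ E + ENNReal.ofReal δ := by
        rw [lintegral_add_right _ measurable_const,
          lintegral_indicator_one (measurableSet_toMeasurable _ _), lintegral_const, measure_univ,
          mul_one]
    _ ≤ ε / 2 + ε / 2 := by
        gcongr
        rw [hE, measure_toMeasurable]
        exact hk3
    _ = ε := ENNReal.add_halves ε

end InProbability


/-! ### Sample means and sample variances of independent copies -/

section SampleVariance

/-- Trades the random centre of a sample variance for a fixed one, so that sums of independent
centred variables appear. -/
lemma sum_sub_mean_sq {κ : Type*} [Fintype κ] [Nonempty κ] (z : κ → ℝ) (m : ℝ) :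
    ∑ b, (z b - (∑ b', z b') / Fintype.card κ) ^ 2
      = ∑ b, (z b - m) ^ 2 - (∑ b, (z b - m)) ^ 2 / Fintype.card κ := by
  have hn : (Fintype.card κ : ℝ) ≠ 0 := by simp
  have h : ∀ a : ℝ, ∑ b, (z b - a) ^ 2 = ∑ b, z b ^ 2 - 2 * a * ∑ b, z b
      + Fintype.card κ * a ^ 2 := fun a => by
    have : ∀ b, (z b - a) ^ 2 = z b ^ 2 - 2 * a * z b + a ^ 2 := fun b => by ring
    simp_rw [this, Finset.sum_add_distrib, Finset.sum_sub_distrib, Finset.mul_sum]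
    simp
  have h' : ∑ b, (z b - m) = ∑ b, z b - Fintype.card κ * m := by
    simp [Finset.sum_sub_distrib]
  rw [h, h, h']
  field_simp
  ring

variable {E : Type*} [MeasurableSpace E] (G : Measure E) [IsProbabilityMeasure G] {B : ℕ}

lemma memLp_eval_pi {p : ℝ≥0∞} {u : E → ℝ} (hu : MemLp u p G) (b : Fin B) :
    MemLp (fun y : Fin B → E => u (y b)) p (Measure.pi fun _ => G) :=
  hu.comp_measurePreserving (measurePreserving_eval (fun _ : Fin B => G) b)

lemma integral_eval_pi {u : E → ℝ} (hu : AEStronglyMeasurable u G) (b : Fin B) :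
    ∫ y : Fin B → E, u (y b) ∂(Measure.pi fun _ => G) = ∫ e, u e ∂G :=
  integral_comp_eval (μ := fun _ : Fin B => G) hu

/-- Moments of the sum of independent copies of a centred random variable. -/
lemma integral_sum_pi {z : E → ℝ} (hz : MemLp z 4 G) (h0 : ∫ e, z e ∂G = 0) :
    ∫ y : Fin B → E, (∑ b, z (y b)) ^ 2 ∂(Measure.pi fun _ => G) = B * ∫ e, z e ^ 2 ∂G ∧
    ∫ y : Fin B → E, (∑ b, z (y b)) ^ 4 ∂(Measure.pi fun _ => G)
      ≤ 3 * (B : ℝ) ^ 2 * ∫ e, z e ^ 4 ∂G := by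
  have hind : iIndepFun (fun (b : Fin B) (y : Fin B → E) => z (y b)) (Measure.pi fun _ => G) :=
    iIndepFun_pi fun _ => hz.1.aemeasurable
  have h := integral_sum_pow_four_le hind (memLp_eval_pi G hz)
    (fun b => by rw [integral_eval_pi G hz.1, h0]) (K := ∫ e, z e ^ 4 ∂G)
    (fun b => (integral_eval_pi G (u := fun e => z e ^ 4) (hz.1.pow 4) b).le) Finset.univ
  simp only [Finset.card_univ, Fintype.card_fin] at h
  refine ⟨?_, h.2⟩
  rw [h.1]
  simp [integral_eval_pi G (u := fun e => z e ^ 2) (hz.1.pow 2)]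

/-- Asks only for square integrability, so it applies to the squares of a variable with four
moments. -/
lemma integral_sum_sq_pi {z : E → ℝ} (hz : MemLp z 2 G) (h0 : ∫ e, z e ∂G = 0) :
    ∫ y : Fin B → E, (∑ b, z (y b)) ^ 2 ∂(Measure.pi fun _ => G) = B * ∫ e, z e ^ 2 ∂G := by
  have h := variance_sum_pi (μ := fun _ : Fin B => G) (X := fun _ => z) fun _ => hz
  rw [variance_of_integral_eq_zero, variance_of_integral_eq_zero hz.1.aemeasurable h0] at h
  · simpa using h
  · exact Finset.aemeasurable_sum _ fun b _ => (memLp_eval_pi G hz b).1.aemeasurable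
  · simp only [Finset.sum_apply]
    rw [integral_finsetSum _ fun b _ => (memLp_eval_pi G hz b).integrable (by norm_num)]
    exact Finset.sum_eq_zero fun b _ => by rw [integral_eval_pi G hz.1, h0]

/-- The mean of independent copies. -/
lemma integral_mean_sub_sq_le {w : E → ℝ} (hw : MemLp w 2 G) (hB : 0 < B) :
    ∫ y : Fin B → E, ((∑ b, w (y b)) / B - ∫ e, w e ∂G) ^ 2 ∂(Measure.pi fun _ => G)
      ≤ (∫ e, w e ^ 2 ∂G) / B := by
  have hB' : (0 : ℝ) < B := by exact_mod_cast hB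
  have hz : MemLp (fun e => w e - ∫ e, w e ∂G) 2 G := hw.sub (memLp_const _)
  have hint := hw.integrable (by norm_num)
  have h0 : ∫ e, (w e - ∫ e, w e ∂G) ∂G = 0 := by
    rw [integral_sub hint (integrable_const _)]; simp
  have h := integral_sum_sq_pi (B := B) G hz h0
  have hv : ∫ e, (w e - ∫ e, w e ∂G) ^ 2 ∂G ≤ ∫ e, w e ^ 2 ∂G := by
    rw [← variance_eq_integral hw.1.aemeasurable]
    exact variance_le_expectation_sq hw.1
  have he : ∀ y : Fin B → E, ((∑ b, w (y b)) / B - ∫ e, w e ∂G) ^ 2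
      = (1 / (B : ℝ) ^ 2) * (∑ b, (w (y b) - ∫ e, w e ∂G)) ^ 2 := fun y => by
    rw [Finset.sum_sub_distrib]
    simp
    field_simp
  simp_rw [he]
  rw [integral_const_mul, h]
  calc 1 / (B : ℝ) ^ 2 * (B * ∫ e, (w e - ∫ e, w e ∂G) ^ 2 ∂G)
      = (∫ e, (w e - ∫ e, w e ∂G) ^ 2 ∂G) / B := by field_simp
    _ ≤ _ := by gcongr

/-- The mean square error of the sample variance. -/
lemma integral_sampleVar_sub_sq_le {u : E → ℝ} (hu : MemLp u 4 G) (hB : 2 ≤ B) :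
    MemLp (fun y : Fin B → E => (∑ b, (u (y b) - (∑ b', u (y b')) / B) ^ 2) / (B - 1)) 2
      (Measure.pi fun _ => G) ∧
    ∫ y : Fin B → E, ((∑ b, (u (y b) - (∑ b', u (y b')) / B) ^ 2) / (B - 1) - Var[u; G]) ^ 2
        ∂(Measure.pi fun _ => G)
      ≤ 20 * (∫ e, (u e - ∫ e, u e ∂G) ^ 4 ∂G) / B := by
  have hB2 : (2 : ℝ) ≤ B := by exact_mod_cast hB
  have hBp : (0 : ℝ) < B := by linarith
  have hB1 : (0 : ℝ) < B - 1 := by linarith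
  have : Nonempty (Fin B) := ⟨⟨0, by omega⟩⟩
  set m := ∫ e, u e ∂G with hm
  set v := Var[u; G] with hv
  set K := ∫ e, (u e - m) ^ 4 ∂G with hK
  have hz : MemLp (fun e => u e - m) 4 G := hu.sub (memLp_const _)
  have h0 : ∫ e, (u e - m) ∂G = 0 := by
    rw [integral_sub (integrable_of_four hu) (integrable_const _)]; simp [hm]
  have hv' : v = ∫ e, (u e - m) ^ 2 ∂G := variance_eq_integral hu.1.aemeasurable
  obtain ⟨hs2, hs4⟩ := integral_sum_pi (B := B) G hz h0
  rw [← hv'] at hs2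
  have hS : MemLp (fun y : Fin B → E => ∑ b, (u (y b) - m)) 4 (Measure.pi fun _ => G) :=
    memLp_finsetSum _ fun b _ => memLp_eval_pi G hz b
  have hq : MemLp (fun e => (u e - m) ^ 2 - v) 2 G := (memLp_sq_of_four hz).sub (memLp_const _)
  have hq0 : ∫ e, ((u e - m) ^ 2 - v) ∂G = 0 := by
    rw [integral_sub (integrable_sq_of_four hz) (integrable_const _)]; simp [hv']
  have hQ := integral_sum_sq_pi (B := B) G hq hq0
  have hqK : ∫ e, ((u e - m) ^ 2 - v) ^ 2 ∂G ≤ K := by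
    have h1 : ∫ e, ((u e - m) ^ 2 - v) ^ 2 ∂G = Var[fun e => (u e - m) ^ 2; G] := by
      rw [variance_eq_integral (X := fun e => (u e - m) ^ 2) (hz.1.pow 2).aemeasurable, ← hv']
    rw [h1]
    refine (variance_le_expectation_sq (hz.1.pow 2)).trans_eq ?_
    rw [hK]; congr 1; ext e; simp only [Pi.pow_apply]; ring
  have hQL : MemLp (fun y : Fin B → E => ∑ b, ((u (y b) - m) ^ 2 - v)) 2
      (Measure.pi fun _ => G) := memLp_finsetSum _ fun b _ => memLp_eval_pi G hq b
  have hP : MemLp (fun y : Fin B → E => (∑ b, (u (y b) - m)) ^ 2 / B) 2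
      (Measure.pi fun _ => G) := by
    simpa [div_eq_mul_inv] using (memLp_sq_of_four hS).mul_const ((B : ℝ)⁻¹)
  have hPm : ∫ y : Fin B → E, (∑ b, (u (y b) - m)) ^ 2 / B ∂(Measure.pi fun _ => G) = v := by
    rw [integral_div, hs2]; field_simp
  have hPv : ∫ y : Fin B → E, ((∑ b, (u (y b) - m)) ^ 2 / B - v) ^ 2 ∂(Measure.pi fun _ => G)
      ≤ 3 * K := by
    have h1 := variance_le_expectation_sq hP.1
    rw [variance_eq_integral hP.1.aemeasurable, hPm] at h1
    refine h1.trans ?_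
    have h2 : ∀ y : Fin B → E, ((fun y : Fin B → E => (∑ b, (u (y b) - m)) ^ 2 / (B : ℝ)) ^ 2) y
        = (∑ b, (u (y b) - m)) ^ 4 / (B : ℝ) ^ 2 := fun y => by
      simp only [Pi.pow_apply]; ring
    simp_rw [h2]
    rw [integral_div, div_le_iff₀ (by positivity)]
    linarith
  have hPv' : MemLp (fun y : Fin B → E => (∑ b, (u (y b) - m)) ^ 2 / B - v) 2
      (Measure.pi fun _ => G) := hP.sub (memLp_const v)
  -- Both terms on the right are centred: the first is a sum of i.i.d. variables, the second is the
  -- error caused by estimating the mean.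
  have he : ∀ y : Fin B → E, (∑ b, (u (y b) - (∑ b', u (y b')) / B) ^ 2) / ((B : ℝ) - 1) - v
      = (1 / ((B : ℝ) - 1)) * (∑ b, ((u (y b) - m) ^ 2 - v)
        - ((∑ b, (u (y b) - m)) ^ 2 / B - v)) := fun y => by
    have := sum_sub_mean_sq (fun b => u (y b)) m
    simp only [Fintype.card_fin] at this
    rw [this, Finset.sum_sub_distrib]
    simp
    field_simp
    ring
  have hD : MemLp (fun y : Fin B → E => (∑ b, (u (y b) - (∑ b', u (y b')) / B) ^ 2)
      / ((B : ℝ) - 1) - v) 2 (Measure.pi fun _ => G) := by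
    simp_rw [he]
    exact (hQL.sub hPv').const_mul _
  refine ⟨(hD.add (memLp_const v)).ae_eq (ae_of_all _ fun y => sub_add_cancel _ _), ?_⟩
  have hle : ∫ y : Fin B → E, ((∑ b, (u (y b) - (∑ b', u (y b')) / B) ^ 2) / ((B : ℝ) - 1) - v) ^ 2
        ∂(Measure.pi fun _ => G)
      ≤ ∫ y : Fin B → E, ((2 / ((B : ℝ) - 1) ^ 2) * (∑ b, ((u (y b) - m) ^ 2 - v)) ^ 2
        + (2 / ((B : ℝ) - 1) ^ 2) * ((∑ b, (u (y b) - m)) ^ 2 / B - v) ^ 2)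
        ∂(Measure.pi fun _ => G) := by
    refine integral_mono hD.integrable_sq
      ((hQL.integrable_sq.const_mul _).add (hPv'.integrable_sq.const_mul _)) fun y => ?_
    simp only [he]
    generalize ∑ b, ((u (y b) - m) ^ 2 - v) = a
    generalize (∑ b, (u (y b) - m)) ^ 2 / (B : ℝ) - v = c
    have : 2 / ((B : ℝ) - 1) ^ 2 * a ^ 2 + 2 / ((B : ℝ) - 1) ^ 2 * c ^ 2
        - (1 / ((B : ℝ) - 1) * (a - c)) ^ 2 = (1 / ((B : ℝ) - 1) * (a + c)) ^ 2 := by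
      field_simp
      ring
    nlinarith [sq_nonneg (1 / ((B : ℝ) - 1) * (a + c))]
  refine hle.trans ?_
  rw [integral_add (hQL.integrable_sq.const_mul _) (hPv'.integrable_sq.const_mul _),
    integral_const_mul, integral_const_mul, hQ]
  have hK0 : 0 ≤ K := integral_nonneg fun e => by positivity
  calc 2 / ((B : ℝ) - 1) ^ 2 * (B * ∫ e, ((u e - m) ^ 2 - v) ^ 2 ∂G)
        + 2 / ((B : ℝ) - 1) ^ 2 * ∫ y : Fin B → E, ((∑ b, (u (y b) - m)) ^ 2 / B - v) ^ 2
          ∂(Measure.pi fun _ => G)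
      ≤ 2 / ((B : ℝ) - 1) ^ 2 * (B * K) + 2 / ((B : ℝ) - 1) ^ 2 * (3 * K) := by gcongr
    _ = (2 * (B + 3) / ((B : ℝ) - 1) ^ 2) * K := by ring
    -- The inequality 2B(B + 3) ≤ 20(B − 1)² is an equality at B = 2, the smallest size allowed.
    _ ≤ (20 / B) * K := by
        gcongr ?_ * K
        rw [div_le_div_iff₀ (by positivity) hBp]
        nlinarith
    _ = 20 * K / B := by ring

/-- The mean square error of the difference of a sample variance and `1 / R` times a mean. -/
lemma integral_sampleVar_sub_mean_le {u w : E → ℝ} (hu : MemLp u 4 G) (hw : MemLp w 2 G)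
    (hB : 2 ≤ B) (R : ℝ) :
    MemLp (fun y : Fin B → E => (∑ b, (u (y b) - (∑ b', u (y b')) / B) ^ 2) / (B - 1)
        - (∑ b, w (y b)) / B / R) 2 (Measure.pi fun _ => G) ∧
    ∫ y : Fin B → E, ((∑ b, (u (y b) - (∑ b', u (y b')) / B) ^ 2) / (B - 1)
        - (∑ b, w (y b)) / B / R - (Var[u; G] - (∫ e, w e ∂G) / R)) ^ 2 ∂(Measure.pi fun _ => G)
      ≤ 40 * (∫ e, (u e - ∫ e, u e ∂G) ^ 4 ∂G) / B + 2 * (∫ e, w e ^ 2 ∂G) / (B * R ^ 2) := by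
  obtain ⟨h1, h2⟩ := integral_sampleVar_sub_sq_le G hu hB
  have h3 := integral_mean_sub_sq_le (B := B) G hw (by omega)
  have h4 : MemLp (fun y : Fin B → E => (∑ b, w (y b)) / B) 2 (Measure.pi fun _ => G) := by
    simpa [div_eq_mul_inv] using
      (memLp_finsetSum Finset.univ fun b _ => memLp_eval_pi G hw b).mul_const ((B : ℝ)⁻¹)
  have h5 : MemLp (fun y : Fin B → E => (∑ b, w (y b)) / B / R) 2 (Measure.pi fun _ => G) := by
    simpa [div_eq_mul_inv] using h4.mul_const (R⁻¹)
  refine ⟨h1.sub h5, ?_⟩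
  have h6 : MemLp (fun y : Fin B → E => (∑ b, (u (y b) - (∑ b', u (y b')) / B) ^ 2) / ((B : ℝ) - 1)
      - Var[u; G]) 2 (Measure.pi fun _ => G) := h1.sub (memLp_const _)
  have h7 : MemLp (fun y : Fin B → E => (∑ b, w (y b)) / B - ∫ e, w e ∂G) 2
      (Measure.pi fun _ => G) := h4.sub (memLp_const _)
  have h8 := (h1.sub h5).sub (memLp_const (Var[u; G] - (∫ e, w e ∂G) / R))
  -- Both errors come from the same copies and may be dependent, so they are separated by (x − y)² ≤
  -- 2x² + 2y² rather than by orthogonality.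
  refine (integral_mono h8.integrable_sq
    ((h6.integrable_sq.const_mul 2).add (h7.integrable_sq.const_mul (2 / R ^ 2)))
    fun y => ?_).trans (b := ∫ y : Fin B → E,
      (2 * ((∑ b, (u (y b) - (∑ b', u (y b')) / B) ^ 2) / ((B : ℝ) - 1) - Var[u; G]) ^ 2
        + 2 / R ^ 2 * ((∑ b, w (y b)) / B - ∫ e, w e ∂G) ^ 2) ∂(Measure.pi fun _ => G)) ?_
  · simp only [Pi.sub_apply, Pi.add_apply]
    generalize (∑ b, (u (y b) - (∑ b', u (y b')) / B) ^ 2) / ((B : ℝ) - 1) = a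
    generalize (∑ b, w (y b)) / (B : ℝ) = c
    generalize ∫ e, w e ∂G = d
    generalize Var[u; G] = v
    have : 2 * (a - v) ^ 2 + 2 / R ^ 2 * (c - d) ^ 2 - (a - c / R - (v - d / R)) ^ 2
      = ((a - v) + (c - d) / R) ^ 2 := by ring
    nlinarith [sq_nonneg ((a - v) + (c - d) / R)]
  rw [integral_add (h6.integrable_sq.const_mul 2) (h7.integrable_sq.const_mul _),
    integral_const_mul, integral_const_mul]
  calc _ ≤ 2 * (20 * (∫ e, (u e - ∫ e, u e ∂G) ^ 4 ∂G) / B)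
        + 2 / R ^ 2 * ((∫ e, w e ^ 2 ∂G) / B) := by gcongr
    _ = _ := by rw [mul_comm (B : ℝ)]; simp only [div_eq_mul_inv, mul_inv]; ring

end SampleVariance

/-! ### A group of replications with a common input -/

section Group

variable {R : ℕ} {ρ : Measure ℝ} [IsProbabilityMeasure ρ] {a : ℝ}

/-- The sample variance of the replications of one group. -/
noncomputable def groupVar (y : Fin R → ℝ) : ℝ := (∑ r, (y r - groupMean y) ^ 2) / (R - 1)

lemma measurable_groupMean : Measurable (groupMean (R := R)) := by
  unfold groupMean; fun_prop

lemma measurable_groupVar : Measurable (groupVar (R := R)) := by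
  unfold groupVar groupMean; fun_prop

lemma groupMean_sub (hR : 0 < R) (y : Fin R → ℝ) (a : ℝ) :
    groupMean y - a = (∑ r, (y r - a)) / R := by
  have : (R : ℝ) ≠ 0 := by positivity
  simp [groupMean, Finset.sum_sub_distrib]
  field_simp

lemma groupVar_nonneg (hR : 0 < R) (y : Fin R → ℝ) : 0 ≤ groupVar y := by
  have : (1 : ℝ) ≤ R := by exact_mod_cast hR
  exact div_nonneg (Finset.sum_nonneg fun r _ => sq_nonneg _) (by linarith)

lemma memLp_group (hρ : MemLp (fun y : ℝ => y - a) 4 ρ) :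
    MemLp (fun y : Fin R → ℝ => ∑ r, (y r - a)) 4 (Measure.pi fun _ => ρ) :=
  memLp_finsetSum _ fun r _ => memLp_eval_pi ρ hρ r

lemma memLp_groupMean (hR : 0 < R) (hρ : MemLp (fun y : ℝ => y - a) 4 ρ) :
    MemLp (fun y : Fin R → ℝ => groupMean y - a) 4 (Measure.pi fun _ => ρ) := by
  simp_rw [groupMean_sub hR, div_eq_mul_inv]
  exact (memLp_group hρ).mul_const _

lemma integral_groupMean (hR : 0 < R) (hρ : MemLp (fun y : ℝ => y - a) 4 ρ)
    (ha : ∫ y, (y - a) ∂ρ = 0) :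
    ∫ y : Fin R → ℝ, (groupMean y - a) ∂(Measure.pi fun _ => ρ) = 0 := by
  simp_rw [groupMean_sub hR]
  rw [integral_div, integral_finsetSum _ fun r _ => integrable_of_four (memLp_eval_pi ρ hρ r)]
  simp [integral_eval_pi ρ hρ.1, ha]

lemma integral_groupMean_sq (hR : 0 < R) (hρ : MemLp (fun y : ℝ => y - a) 4 ρ)
    (ha : ∫ y, (y - a) ∂ρ = 0) :
    ∫ y : Fin R → ℝ, (groupMean y - a) ^ 2 ∂(Measure.pi fun _ => ρ)
      = (∫ y, (y - a) ^ 2 ∂ρ) / R := by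
  have : (R : ℝ) ≠ 0 := by positivity
  simp_rw [groupMean_sub hR, div_pow]
  rw [integral_div, (integral_sum_pi ρ hρ ha).1]
  field_simp

lemma integral_groupMean_pow_four_le (hR : 0 < R) (hρ : MemLp (fun y : ℝ => y - a) 4 ρ)
    (ha : ∫ y, (y - a) ∂ρ = 0) :
    ∫ y : Fin R → ℝ, (groupMean y - a) ^ 4 ∂(Measure.pi fun _ => ρ)
      ≤ 3 * (∫ y, (y - a) ^ 4 ∂ρ) / R ^ 2 := by
  have : (0 : ℝ) < R := by positivity
  simp_rw [groupMean_sub hR, div_pow]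
  rw [integral_div, div_le_div_iff₀ (by positivity) (by positivity)]
  have := (integral_sum_pi (B := R) ρ hρ ha).2
  nlinarith [pow_pos ‹(0 : ℝ) < R› 2]

lemma groupVar_eq (hR : 0 < R) (y : Fin R → ℝ) (a : ℝ) :
    groupVar y = (∑ r, (y r - a) ^ 2 - R * (groupMean y - a) ^ 2) / (R - 1) := by
  have : Nonempty (Fin R) := ⟨⟨0, hR⟩⟩
  have : (R : ℝ) ≠ 0 := by positivity
  have h := sum_sub_mean_sq y a
  rw [Fintype.card_fin] at h
  rw [groupMean_sub hR, groupVar]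
  unfold groupMean
  rw [h]
  congr 2
  field_simp

lemma memLp_groupVar (hR : 0 < R) (hρ : MemLp (fun y : ℝ => y - a) 4 ρ) :
    MemLp (groupVar (R := R)) 2 (Measure.pi fun _ => ρ) := by
  have h : (groupVar (R := R)) = fun y => (∑ r, (y r - a) ^ 2 - R * (groupMean y - a) ^ 2)
      * ((R : ℝ) - 1)⁻¹ := by
    ext y; rw [groupVar_eq hR y a, div_eq_mul_inv]
  rw [h]
  have h1 : MemLp (fun y : Fin R → ℝ => ∑ r, (y r - a) ^ 2) 2 (Measure.pi fun _ => ρ) :=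
    memLp_finsetSum _ fun r _ => memLp_eval_pi ρ (u := fun y => (y - a) ^ 2) (memLp_sq_of_four hρ) r
  exact (h1.sub ((memLp_sq_of_four (memLp_groupMean hR hρ)).const_mul (R : ℝ))).mul_const _

/-- Unbiasedness: R τ² minus R · τ²/R leaves (R − 1) τ². -/
lemma integral_groupVar (hR : 2 ≤ R) (hρ : MemLp (fun y : ℝ => y - a) 4 ρ)
    (ha : ∫ y, (y - a) ∂ρ = 0) :
    ∫ y : Fin R → ℝ, groupVar y ∂(Measure.pi fun _ => ρ) = ∫ y, (y - a) ^ 2 ∂ρ := by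
  have hR' : (2 : ℝ) ≤ R := by exact_mod_cast hR
  have h1 : (R : ℝ) - 1 ≠ 0 := by linarith
  simp_rw [groupVar_eq (show 0 < R by omega) _ a]
  have h2 (r : Fin R) : Integrable (fun y : Fin R → ℝ => (y r - a) ^ 2) (Measure.pi fun _ => ρ) :=
    integrable_sq_of_four (memLp_eval_pi ρ hρ r)
  have h3 := integrable_sq_of_four (memLp_groupMean (show 0 < R by omega) hρ)
  rw [integral_div, integral_sub (integrable_finsetSum _ fun r _ => h2 r) (h3.const_mul _),
    integral_finsetSum _ fun r _ => h2 r, integral_const_mul,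
    integral_groupMean_sq (by omega) hρ ha]
  simp_rw [integral_eval_pi ρ (u := fun y => (y - a) ^ 2) (hρ.1.pow 2)]
  simp
  field_simp

/-- Dropping the squared mean and applying Cauchy–Schwarz gives the factor R²/(R − 1)², which is at
most 4 for R ≥ 2. The bound is thus uniform in R. -/
lemma integral_groupVar_sq_le (hR : 2 ≤ R) (hρ : MemLp (fun y : ℝ => y - a) 4 ρ) :
    ∫ y : Fin R → ℝ, groupVar y ^ 2 ∂(Measure.pi fun _ => ρ) ≤ 4 * ∫ y, (y - a) ^ 4 ∂ρ := by
  have hR' : (2 : ℝ) ≤ R := by exact_mod_cast hR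
  have h1 : (0 : ℝ) < (R : ℝ) - 1 := by linarith
  have h4 (r : Fin R) : Integrable (fun y : Fin R → ℝ => (y r - a) ^ 4) (Measure.pi fun _ => ρ) :=
    integrable_pow_four (memLp_eval_pi ρ hρ r)
  have hle : ∫ y : Fin R → ℝ, groupVar y ^ 2 ∂(Measure.pi fun _ => ρ)
      ≤ ∫ y : Fin R → ℝ, (R / ((R : ℝ) - 1) ^ 2) * ∑ r, (y r - a) ^ 4 ∂(Measure.pi fun _ => ρ) := by
    refine integral_mono (memLp_groupVar (by omega) hρ).integrable_sq
      ((integrable_finsetSum _ fun r _ => h4 r).const_mul _) fun y => ?_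
    have h5 : groupVar y ≤ (∑ r, (y r - a) ^ 2) / ((R : ℝ) - 1) := by
      rw [groupVar_eq (show 0 < R by omega) y a]
      gcongr
      have : 0 ≤ (R : ℝ) * (groupMean y - a) ^ 2 := by positivity
      linarith
    calc groupVar y ^ 2 ≤ ((∑ r, (y r - a) ^ 2) / ((R : ℝ) - 1)) ^ 2 := by
          have := groupVar_nonneg (show 0 < R by omega) y
          gcongr
      _ = (∑ r, (y r - a) ^ 2) ^ 2 / ((R : ℝ) - 1) ^ 2 := div_pow _ _ _
      _ ≤ (R * ∑ r, ((y r - a) ^ 2) ^ 2) / ((R : ℝ) - 1) ^ 2 := by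
          gcongr
          simpa using sq_sum_le_card_mul_sum_sq (s := Finset.univ) (f := fun r => (y r - a) ^ 2)
      _ = _ := by
          have : ∀ r, ((y r - a) ^ 2) ^ 2 = (y r - a) ^ 4 := fun r => by ring
          simp_rw [this]; ring
  refine hle.trans ?_
  rw [integral_const_mul, integral_finsetSum _ fun r _ => h4 r]
  simp_rw [integral_eval_pi ρ (u := fun y => (y - a) ^ 4) (hρ.1.pow 4)]
  have hp : 0 ≤ ∫ y, (y - a) ^ 4 ∂ρ := integral_nonneg fun y => by positivity
  simp only [Finset.sum_const, Finset.card_univ, Fintype.card_fin, nsmul_eq_mul]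
  rw [← mul_assoc]
  gcongr ?_ * _
  rw [div_mul_eq_mul_div, div_le_iff₀ (by positivity)]
  nlinarith

end Group


/-! ### Mixtures over a finite set of inputs -/

section Mixture

variable {D β : Type*} [Fintype D] [MeasurableSpace D] [DiscreteMeasurableSpace D]
  [MeasurableSpace β]

/-- There are finitely many draws, so the mixture is a finite weighted sum and no integrability in
the draw has to be checked. -/
lemma bind_eq_sum (ν : Measure D) (κ : D → Measure β) :
    ν.bind κ = ∑ J, ν {J} • κ J := by
  ext s hs
  rw [Measure.bind_apply hs Measurable.of_discrete.aemeasurable, lintegral_fintype]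
  simp [mul_comm]

omit [Fintype D] in
lemma isProbabilityMeasure_bind_of_finite (ν : Measure D) [IsProbabilityMeasure ν]
    (κ : D → Measure β) [∀ J, IsProbabilityMeasure (κ J)] : IsProbabilityMeasure (ν.bind κ) := by
  constructor
  rw [Measure.bind_apply .univ Measurable.of_discrete.aemeasurable]
  simp

lemma integral_bind_of_finite (ν : Measure D) [IsFiniteMeasure ν] (κ : D → Measure β) {f : β → ℝ}
    (hf : ∀ J, Integrable f (κ J)) :
    Integrable f (ν.bind κ) ∧ ∫ y, f y ∂(ν.bind κ) = ∫ J, ∫ y, f y ∂(κ J) ∂ν := by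
  have h : ∀ J ∈ Finset.univ, Integrable f (ν {J} • κ J) := fun J _ =>
    (hf J).smul_measure (measure_ne_top _ _)
  rw [bind_eq_sum]
  refine ⟨integrable_finsetSum_measure.2 h, ?_⟩
  rw [integral_finsetSum_measure h, integral_fintype .of_finite]
  simp [integral_smul_measure, Measure.real]

end Mixture

/-! ### The law of one group, and the error of the estimate built from `B` groups -/

section GroupLaw

variable {D : Type*} [Fintype D] [MeasurableSpace D] [DiscreteMeasurableSpace D]
  {ν : Measure D} [IsProbabilityMeasure ν] {ρ : D → Measure ℝ} [∀ J, IsProbabilityMeasure (ρ J)]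
  {p : D → ℝ} {B R : ℕ}

/-- The law of a group of replications whose common input has law `ν`. -/
noncomputable def groupLaw (ν : Measure D) (ρ : D → Measure ℝ) (R : ℕ) : Measure (Fin R → ℝ) :=
  ν.bind fun J => Measure.pi fun _ : Fin R => ρ J

instance : IsProbabilityMeasure (groupLaw ν ρ R) :=
  isProbabilityMeasure_bind_of_finite ν _

omit [∀ J, IsProbabilityMeasure (ρ J)] in
lemma integral_groupLaw {f : (Fin R → ℝ) → ℝ}
    (hf : ∀ J, Integrable f (Measure.pi fun _ : Fin R => ρ J)) :
    Integrable f (groupLaw ν ρ R) ∧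
      ∫ y, f y ∂(groupLaw ν ρ R) = ∫ J, ∫ y, f y ∂(Measure.pi fun _ : Fin R => ρ J) ∂ν :=
  integral_bind_of_finite ν _ hf

variable (hρ : ∀ J, MemLp (fun y : ℝ => y - p J) 4 (ρ J)) (hp : ∀ J, ∫ y, (y - p J) ∂(ρ J) = 0)

omit [Fintype D] [MeasurableSpace D] [DiscreteMeasurableSpace D] in
include hρ in
lemma memLp_groupMean_sub (hR : 0 < R) (c : ℝ) (J : D) :
    MemLp (fun y : Fin R → ℝ => groupMean y - c) 4 (Measure.pi fun _ => ρ J) := by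
  refine ((memLp_groupMean hR (hρ J)).add (memLp_const (p J - c))).ae_eq
    (ae_of_all _ fun y => ?_)
  simp

include hρ in
lemma memLp_groupMean_groupLaw (hR : 0 < R) : MemLp (groupMean (R := R)) 4 (groupLaw ν ρ R) := by
  rw [memLp_four_iff measurable_groupMean.aestronglyMeasurable]
  refine (integral_groupLaw fun J => ?_).1
  simpa using integrable_pow_four (memLp_groupMean_sub hρ hR 0 J)

include hρ in
lemma memLp_groupVar_groupLaw (hR : 0 < R) : MemLp (groupVar (R := R)) 2 (groupLaw ν ρ R) := by
  rw [memLp_two_iff_integrable_sq measurable_groupVar.aestronglyMeasurable]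
  exact (integral_groupLaw fun J => (memLp_groupVar hR (hρ J)).integrable_sq).1

include hρ hp in
lemma integral_groupMean_groupLaw (hR : 0 < R) :
    ∫ y, groupMean y ∂(groupLaw ν ρ R) = ∫ J, p J ∂ν := by
  have hi : ∀ J, Integrable (groupMean (R := R)) (Measure.pi fun _ : Fin R => ρ J) := fun J => by
    simpa using integrable_of_four (memLp_groupMean_sub hρ hR 0 J)
  rw [(integral_groupLaw hi).2]
  congr 1; ext J
  have h := integral_groupMean hR (hρ J) (hp J)
  rw [integral_sub (hi J) (integrable_const _)] at h
  simpa [sub_eq_zero] using h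

include hρ hp in
/-- The law of total variance. -/
lemma variance_groupMean_groupLaw (hR : 0 < R) :
    Var[groupMean; groupLaw ν ρ R]
      = Var[p; ν] + (∫ J, ∫ y, (y - p J) ^ 2 ∂(ρ J) ∂ν) / R := by
  rw [variance_eq_integral measurable_groupMean.aemeasurable,
    integral_groupMean_groupLaw hρ hp hR,
    variance_eq_integral (Measurable.of_discrete (f := p)).aemeasurable]
  set m := ∫ J, p J ∂ν
  rw [(integral_groupLaw fun J => integrable_sq_of_four (memLp_groupMean_sub hρ hR m J)).2,
    ← integral_div, ← integral_add .of_finite .of_finite]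
  congr 1; ext J
  have h1 := integrable_of_four (memLp_groupMean hR (hρ J))
  have h2 := integrable_sq_of_four (memLp_groupMean hR (hρ J))
  -- Split at the conditional mean `p J`; the cross term has conditional mean zero.
  have he : ∀ y : Fin R → ℝ, (groupMean y - m) ^ 2
      = (groupMean y - p J) ^ 2 + (2 * (p J - m) * (groupMean y - p J) + (p J - m) ^ 2) :=
    fun y => by ring
  have h3 : Integrable (fun y : Fin R → ℝ => 2 * (p J - m) * (groupMean y - p J) + (p J - m) ^ 2)
    (Measure.pi fun _ => ρ J) := (h1.const_mul _).add (integrable_const _)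
  simp_rw [he]
  rw [integral_add h2 h3,
    integral_add (h1.const_mul _) (integrable_const _), integral_const_mul,
    integral_groupMean hR (hρ J) (hp J), integral_groupMean_sq hR (hρ J) (hp J)]
  simp
  ring

include hρ hp in
-- This is the same averaged simulation variance that inflates `variance_groupMean_groupLaw`, so
-- subtracting V/R removes the inflation exactly.
lemma integral_groupVar_groupLaw (hR : 2 ≤ R) :
    ∫ y, groupVar y ∂(groupLaw ν ρ R) = ∫ J, ∫ y, (y - p J) ^ 2 ∂(ρ J) ∂ν := by
  rw [(integral_groupLaw fun J =>
    (memLp_groupVar (show 0 < R by omega) (hρ J)).integrable (by norm_num)).2]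
  congr 1; ext J
  exact integral_groupVar hR (hρ J) (hp J)

include hρ in
lemma integral_groupVar_sq_groupLaw_le (hR : 2 ≤ R) :
    ∫ y, groupVar y ^ 2 ∂(groupLaw ν ρ R) ≤ 4 * ∫ J, ∫ y, (y - p J) ^ 4 ∂(ρ J) ∂ν := by
  rw [(integral_groupLaw fun J =>
    (memLp_groupVar (show 0 < R by omega) (hρ J)).integrable_sq).2, ← integral_const_mul]
  exact integral_mono .of_finite .of_finite fun J => integral_groupVar_sq_le hR (hρ J)

include hρ hp in
-- The group mean deviates from `c` by simulation noise around `p J` and by the resampling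
-- fluctuation `p J - c`. The constant is 128 = 16 · 8, from recentring and from `add_pow_four_le`.
-- The centre `c` stays free; later it is ψ at the empirical distributions.
lemma integral_groupMean_pow_four_groupLaw_le (hR : 0 < R) (c : ℝ) :
    ∫ y, (groupMean y - ∫ y', groupMean y' ∂(groupLaw ν ρ R)) ^ 4 ∂(groupLaw ν ρ R)
      ≤ 128 * (3 * (∫ J, ∫ y, (y - p J) ^ 4 ∂(ρ J) ∂ν) / R ^ 2 + ∫ J, (p J - c) ^ 4 ∂ν) := by
  refine (integral_sub_mean_pow_four_le (memLp_groupMean_groupLaw hρ hR) c).trans ?_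
  rw [(integral_groupLaw fun J => integrable_pow_four (memLp_groupMean_sub hρ hR c J)).2]
  have h : ∫ J, ∫ y, (groupMean y - c) ^ 4 ∂(Measure.pi fun _ : Fin R => ρ J) ∂ν
      ≤ ∫ J, 8 * (3 * (∫ y, (y - p J) ^ 4 ∂(ρ J)) / R ^ 2 + (p J - c) ^ 4) ∂ν := by
    refine integral_mono .of_finite .of_finite fun J => ?_
    have h4 := integrable_pow_four (memLp_groupMean hR (hρ J))
    have hle : ∫ y, (groupMean y - c) ^ 4 ∂(Measure.pi fun _ : Fin R => ρ J)
        ≤ ∫ y, 8 * ((groupMean y - p J) ^ 4 + (p J - c) ^ 4) ∂(Measure.pi fun _ : Fin R => ρ J) := by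
      refine integral_mono (integrable_pow_four (memLp_groupMean_sub hρ hR c J))
        ((h4.add (integrable_const _)).const_mul 8) fun y => ?_
      simpa using add_pow_four_le (groupMean y - p J) (p J - c)
    refine hle.trans ?_
    rw [integral_const_mul, integral_add h4 (integrable_const _)]
    have := integral_groupMean_pow_four_le hR (hρ J) (hp J)
    simp
    linarith
  rw [integral_const_mul, integral_add .of_finite .of_finite, integral_div,
    integral_const_mul] at h
  linarith

/-- Exhibits V as the average of the group variances, so that the estimate is built from one i.i.d.
family indexed by the groups. -/
lemma svbEstimate_eq (θ : ℝ) (y : Fin B → Fin R → ℝ) :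
    svbEstimate θ y = θ * ((∑ b, (groupMean (y b) - (∑ b', groupMean (y b')) / B) ^ 2) / (B - 1)
      - (∑ b, groupVar (y b)) / B / R) := by
  unfold svbEstimate groupVar
  rw [← Finset.sum_div, div_div _ ((R : ℝ) - 1), mul_comm (B : ℝ)]

lemma measurable_svbEstimate (θ : ℝ) : Measurable (svbEstimate θ (B := B) (R := R)) := by
  have := measurable_groupMean (R := R)
  have := measurable_groupVar (R := R)
  have h : svbEstimate θ (B := B) (R := R) = _ := funext fun y => svbEstimate_eq θ y
  rw [h]
  fun_prop

include hρ hp in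
/-- The conditional mean square error of the estimate of the variance of `p` under `ν`. -/
lemma integral_svbEstimate_sub_sq_le (hB : 2 ≤ B) (hR : 2 ≤ R) (θ c σ : ℝ) :
    MemLp (fun y => svbEstimate θ y - σ) 2 (Measure.pi fun _ : Fin B => groupLaw ν ρ R) ∧
    ∫ y, (svbEstimate θ y - σ) ^ 2 ∂(Measure.pi fun _ : Fin B => groupLaw ν ρ R)
      ≤ 2 * θ ^ 2 * (5120 * (∫ J, (p J - c) ^ 4 ∂ν) / B
          + 15368 * (∫ J, ∫ y, (y - p J) ^ 4 ∂(ρ J) ∂ν) / (B * R ^ 2))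
        + 2 * (θ * Var[p; ν] - σ) ^ 2 := by
  have hB0 : (0 : ℝ) < B := by positivity
  have hR0 : (0 : ℝ) < R := by positivity
  obtain ⟨h1, h2⟩ := integral_sampleVar_sub_mean_le (groupLaw ν ρ R) (B := B)
    (memLp_groupMean_groupLaw hρ (show 0 < R by omega))
    (memLp_groupVar_groupLaw hρ (show 0 < R by omega)) hB R
  have h3 : Var[groupMean; groupLaw ν ρ R] - (∫ y, groupVar y ∂(groupLaw ν ρ R)) / R
      = Var[p; ν] := by
    rw [variance_groupMean_groupLaw hρ hp (by omega), integral_groupVar_groupLaw hρ hp hR]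
    ring
  rw [h3] at h2
  have h4 := integral_groupMean_pow_four_groupLaw_le (ν := ν) hρ hp (show 0 < R by omega) c
  have h5 := integral_groupVar_sq_groupLaw_le (ν := ν) hρ hR
  simp_rw [svbEstimate_eq]
  set T : (Fin B → Fin R → ℝ) → ℝ := fun y =>
    (∑ b, (groupMean (y b) - (∑ b', groupMean (y b')) / B) ^ 2) / ((B : ℝ) - 1)
      - (∑ b, groupVar (y b)) / B / R with hT
  change MemLp (fun y => θ * T y - σ) 2 _ ∧ ∫ y, (θ * T y - σ) ^ 2 ∂_ ≤ _
  have hL : MemLp (fun y => θ * T y - σ) 2 (Measure.pi fun _ : Fin B => groupLaw ν ρ R) :=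
    (h1.const_mul θ).sub (memLp_const σ)
  have hL' : MemLp (fun y => T y - Var[p; ν]) 2 (Measure.pi fun _ : Fin B => groupLaw ν ρ R) :=
    h1.sub (memLp_const _)
  refine ⟨hL, ?_⟩
  have hle : ∫ y, (θ * T y - σ) ^ 2 ∂(Measure.pi fun _ : Fin B => groupLaw ν ρ R)
      ≤ ∫ y, (2 * θ ^ 2 * (T y - Var[p; ν]) ^ 2 + 2 * (θ * Var[p; ν] - σ) ^ 2)
        ∂(Measure.pi fun _ : Fin B => groupLaw ν ρ R) := by
    refine integral_mono hL.integrable_sq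
      ((hL'.integrable_sq.const_mul _).add (integrable_const _)) fun y => ?_
    simp only
    -- Fluctuation around θ Var[p] and bias θ Var[p] − σ, separated by (x + y)² ≤ 2x² + 2y².
    nlinarith [sq_nonneg (θ * (T y - Var[p; ν]) - (θ * Var[p; ν] - σ))]
  refine hle.trans ?_
  rw [integral_add (hL'.integrable_sq.const_mul _) (integrable_const _), integral_const_mul]
  simp only [integral_const, probReal_univ, one_smul]
  gcongr
  refine h2.trans ?_
  -- Here 5120 = 40 · 128 and 15368 = 40 · 128 · 3 + 2 · 4.
  calc _ ≤ 40 * (128 * (3 * (∫ J, ∫ y, (y - p J) ^ 4 ∂(ρ J) ∂ν) / R ^ 2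
          + ∫ J, (p J - c) ^ 4 ∂ν)) / B
        + 2 * (4 * ∫ J, ∫ y, (y - p J) ^ 4 ∂(ρ J) ∂ν) / (B * R ^ 2) := by gcongr
    _ = _ := by field_simp; ring

include hρ hp in
/-- Chebyshev's inequality for the estimate. -/
lemma map_svbEstimate_le (hB : 2 ≤ B) (hR : 2 ≤ R) (θ c : ℝ) {σ ε : ℝ} (hσ : 0 < σ)
    (hε : 0 < ε) :
    ((Measure.pi fun _ : Fin B => groupLaw ν ρ R).map (svbEstimate θ)) {v | ε ≤ |v / σ - 1|}
      ≤ ENNReal.ofReal ((2 * θ ^ 2 * (5120 * (∫ J, (p J - c) ^ 4 ∂ν) / B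
          + 15368 * (∫ J, ∫ y, (y - p J) ^ 4 ∂(ρ J) ∂ν) / (B * R ^ 2))
        + 2 * (θ * Var[p; ν] - σ) ^ 2) / (ε * σ) ^ 2) := by
  obtain ⟨h1, h2⟩ := integral_svbEstimate_sub_sq_le (ν := ν) (B := B) hρ hp hB hR θ c σ
  have hεσ : 0 < (ε * σ) ^ 2 := by positivity
  rw [Measure.map_apply (measurable_svbEstimate θ) (measurableSet_le measurable_const (by fun_prop))]
  have h3 := mul_meas_ge_le_integral_of_nonneg (ae_of_all _ fun y => sq_nonneg _)
    h1.integrable_sq ((ε * σ) ^ 2)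
  rw [← ofReal_measureReal]
  apply ENNReal.ofReal_le_ofReal
  rw [le_div_iff₀ hεσ, mul_comm]
  refine le_trans ?_ (h3.trans h2)
  gcongr
  · exact measure_ne_top _ _
  · intro y hy
    simp only [Set.mem_preimage, Set.mem_ofPred_eq] at hy ⊢
    rw [← sq_abs (svbEstimate θ y - σ)]
    gcongr
    have h4 : svbEstimate θ y / σ - 1 = (svbEstimate θ y - σ) / σ := by field_simp
    rw [h4, abs_div, abs_of_pos hσ, le_div_iff₀ hσ] at hy
    exact hy

end GroupLaw


/-! ### Uniform sampling with replacement -/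

section Draws

/-- Both measures give each point the inverse of the product of the cardinalities. Uniform choice of
a whole draw thereby becomes independence of its indices. -/
lemma uniformOn_univ_pi {ι : Type*} [Fintype ι] {α : ι → Type*} [∀ i, Fintype (α i)]
    [∀ i, Nonempty (α i)] [∀ i, MeasurableSpace (α i)] [∀ i, MeasurableSingletonClass (α i)] :
    (uniformOn Set.univ : Measure (∀ i, α i)) = Measure.pi fun _ => uniformOn Set.univ := by
  classical
  refine Measure.ext_of_singleton fun x => ?_
  rw [Measure.pi_singleton, uniformOn_univ]
  simp_rw [uniformOn_univ, Measure.count_singleton, Fintype.card_pi, one_div]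
  rw [Nat.cast_prod, ENNReal.prod_inv_distrib]
  · intro _ _ j _ _
    exact Or.inr (ENNReal.natCast_ne_top _)

lemma integral_uniformOn_univ {n : ℕ} (f : Fin n → ℝ) :
    ∫ j, f j ∂(uniformOn Set.univ) = (∑ j, f j) / n := by
  rw [integral_fintype .of_finite]
  simp [Measure.real, uniformOn_univ, Finset.sum_mul, div_eq_mul_inv, mul_comm]

lemma sum_pow_four_le {ι : Type*} [Fintype ι] (z : ι → ℝ) :
    (∑ i, z i) ^ 4 ≤ (Fintype.card ι : ℝ) ^ 3 * ∑ i, z i ^ 4 := by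
  have h1 : (∑ i, z i) ^ 2 ≤ Fintype.card ι * ∑ i, z i ^ 2 := sq_sum_le_card_mul_sum_sq
  have h2 : (∑ i, z i ^ 2) ^ 2 ≤ Fintype.card ι * ∑ i, (z i ^ 2) ^ 2 := sq_sum_le_card_mul_sum_sq
  have h3 : ∀ i, (z i ^ 2) ^ 2 = z i ^ 4 := fun i => by ring
  simp_rw [h3] at h2
  calc (∑ i, z i) ^ 4 = ((∑ i, z i) ^ 2) ^ 2 := by ring
    _ ≤ (Fintype.card ι * ∑ i, z i ^ 2) ^ 2 := by gcongr
    _ = (Fintype.card ι : ℝ) ^ 2 * (∑ i, z i ^ 2) ^ 2 := by ring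
    _ ≤ (Fintype.card ι : ℝ) ^ 2 * (Fintype.card ι * ∑ i, z i ^ 4) := by gcongr
    _ = _ := by ring

variable {ι : Type*} [Fintype ι] {n s : ι → ℕ}

instance (n s : ι → ℕ) : DiscreteMeasurableSpace (Draw n s) :=
  MeasurableSingletonClass.toDiscreteMeasurableSpace

lemma isProbabilityMeasure_drawLaw (hn : ∀ i, 0 < n i) : IsProbabilityMeasure (drawLaw n s) := by
  have (i : ι) : Nonempty (Fin (n i)) := ⟨⟨0, hn i⟩⟩
  exact instIsProbabilityMeasure_uniformOn_univ

lemma drawLaw_eq_pi (hn : ∀ i, 0 < n i) :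
    drawLaw n s = Measure.pi fun i => Measure.pi fun _ : Fin (s i) =>
      (uniformOn Set.univ : Measure (Fin (n i))) := by
  have (i : ι) : Nonempty (Fin (n i)) := ⟨⟨0, hn i⟩⟩
  rw [drawLaw, uniformOn_univ_pi]
  congr 1; ext1 i
  exact uniformOn_univ_pi

/-- No draw is negligible, so finiteness of E_*[μ₄] forces μ₄ to be finite at every single draw. -/
lemma drawLaw_singleton_ne_zero (J : Draw n s) : drawLaw n s {J} ≠ 0 := by
  classical
  rw [drawLaw, uniformOn_univ, Measure.count_singleton]
  exact ENNReal.div_ne_zero.2 ⟨one_ne_zero, ENNReal.natCast_ne_top _⟩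

/-- The sum of the resampled means. -/
noncomputable def drawMean (a : ∀ i, Fin (n i) → ℝ) (J : Draw n s) : ℝ :=
  ∑ i, (∑ l, a i (J i l)) / s i

variable {a : ∀ i, Fin (n i) → ℝ}

lemma variance_drawMean (hn : ∀ i, 0 < n i) (hs : ∀ i, 0 < s i) (ha : ∀ i, ∑ j, a i j = 0) :
    Var[drawMean a; drawLaw n s] = ∑ i, (∑ j, a i j ^ 2) / n i / s i := by
  have (i : ι) : Nonempty (Fin (n i)) := ⟨⟨0, hn i⟩⟩
  rw [drawLaw_eq_pi hn]
  have h := variance_sum_pi (μ := fun i => Measure.pi fun _ : Fin (s i) =>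
      (uniformOn Set.univ : Measure (Fin (n i))))
    (X := fun i (y : Fin (s i) → Fin (n i)) => (∑ l, a i (y l)) / s i) fun i => .of_discrete
  have he : drawMean (s := s) a
      = ∑ i, fun J : Draw n s => (∑ l, a i (J i l)) / (s i : ℝ) := by
    ext J; simp [drawMean]
  rw [he, h]
  refine Finset.sum_congr rfl fun i _ => ?_
  have hs' : (s i : ℝ) ≠ 0 := by have := hs i; positivity
  have h0 : ∫ j, a i j ∂(uniformOn Set.univ) = 0 := by
    rw [integral_uniformOn_univ, ha]; simp
  have h1 := integral_sum_pi (B := s i) (uniformOn Set.univ : Measure (Fin (n i))) (z := a i)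
    .of_discrete h0
  rw [variance_of_integral_eq_zero]
  · simp_rw [div_pow]
    rw [integral_div, h1.1, integral_uniformOn_univ]
    field_simp
  · exact Measurable.of_discrete.aemeasurable
  · rw [integral_div, integral_finsetSum _ fun l _ => .of_finite]
    simp [integral_eval_pi _ (Measurable.of_discrete (f := a i)).aestronglyMeasurable, h0]

lemma integral_drawMean_pow_four_le (hn : ∀ i, 0 < n i) (hs : ∀ i, 0 < s i)
    (ha : ∀ i, ∑ j, a i j = 0) :
    ∫ J, drawMean a J ^ 4 ∂(drawLaw n s)
      ≤ 3 * (Fintype.card ι : ℝ) ^ 3 * ∑ i, (∑ j, a i j ^ 4) / n i / s i ^ 2 := by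
  have (i : ι) : Nonempty (Fin (n i)) := ⟨⟨0, hn i⟩⟩
  have := isProbabilityMeasure_drawLaw (s := s) hn
  refine (integral_mono .of_finite .of_finite fun J => sum_pow_four_le _).trans ?_
  rw [integral_const_mul, integral_finsetSum _ fun l _ => .of_finite, mul_comm 3, mul_assoc,
    Finset.mul_sum _ _ 3]
  gcongr with i
  have hs' : (0 : ℝ) < s i := by have := hs i; positivity
  have h0 : ∫ j, a i j ∂(uniformOn Set.univ) = 0 := by
    rw [integral_uniformOn_univ, ha]; simp
  have h1 := (integral_sum_pi (B := s i) (uniformOn Set.univ : Measure (Fin (n i))) (z := a i)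
    .of_discrete h0).2
  rw [drawLaw_eq_pi hn, integral_comp_eval (μ := fun i => Measure.pi fun _ : Fin (s i) =>
      (uniformOn Set.univ : Measure (Fin (n i))))
    (f := fun y : Fin (s i) → Fin (n i) => ((∑ l, a i (y l)) / (s i : ℝ)) ^ 4)
    (Measurable.of_discrete).aestronglyMeasurable]
  simp_rw [div_pow]
  rw [integral_div, div_le_iff₀ (by positivity)]
  refine h1.trans_eq ?_
  rw [integral_uniformOn_univ]
  field_simp

variable {p e : Draw n s → ℝ} {c : ℝ}

/-- Variance of a resampled quantity that is close to a sum of resampled means. -/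
lemma abs_variance_draw_sub_le (hn : ∀ i, 0 < n i) (hs : ∀ i, 0 < s i)
    (ha : ∀ i, ∑ j, a i j = 0) (hp : ∀ J, p J = c + drawMean a J + e J) :
    |Var[p; drawLaw n s] - ∑ i, (∑ j, a i j ^ 2) / n i / s i|
      ≤ √(∫ J, e J ^ 4 ∂(drawLaw n s)) + 2 * √((∑ i, (∑ j, a i j ^ 2) / n i / s i)
        * √(∫ J, e J ^ 4 ∂(drawLaw n s))) := by
  have := isProbabilityMeasure_drawLaw (s := s) hn
  have h1 := abs_variance_add_sub_le (μ := drawLaw n s) (f := drawMean a) (h := e)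
    .of_discrete .of_discrete
  have h2 : Var[p; drawLaw n s] = Var[fun J => drawMean a J + e J; drawLaw n s] := by
    rw [← variance_const_add (X := fun J => drawMean a J + e J)
      (Measurable.of_discrete).aestronglyMeasurable c]
    congr 1; ext J; rw [hp]; ring
  rw [← variance_drawMean hn hs ha, h2]
  -- The assumption on the remainder is about its fourth moment, which controls the second through a
  -- square root.
  have h3 : ∫ J, e J ^ 2 ∂(drawLaw n s) ≤ √(∫ J, e J ^ 4 ∂(drawLaw n s)) :=
    integral_sq_le_sqrt .of_discrete
  refine h1.trans ?_
  have := variance_nonneg (drawMean (s := s) a) (drawLaw n s)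
  gcongr

lemma integral_draw_sub_pow_four_le (hn : ∀ i, 0 < n i) (hs : ∀ i, 0 < s i)
    (ha : ∀ i, ∑ j, a i j = 0) (hp : ∀ J, p J = c + drawMean a J + e J) :
    ∫ J, (p J - c) ^ 4 ∂(drawLaw n s)
      ≤ 8 * (3 * (Fintype.card ι : ℝ) ^ 3 * ∑ i, (∑ j, a i j ^ 4) / n i / s i ^ 2
        + ∫ J, e J ^ 4 ∂(drawLaw n s)) := by
  have := isProbabilityMeasure_drawLaw (s := s) hn
  have h1 : ∫ J, (p J - c) ^ 4 ∂(drawLaw n s)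
      ≤ ∫ J, 8 * (drawMean a J ^ 4 + e J ^ 4) ∂(drawLaw n s) := by
    refine integral_mono .of_finite .of_finite fun J => ?_
    have : p J - c = drawMean a J + e J := by rw [hp]; ring
    simp only [this]
    exact add_pow_four_le _ _
  refine h1.trans ?_
  rw [integral_const_mul, integral_add .of_finite .of_finite]
  gcongr
  exact integral_drawMean_pow_four_le hn hs ha

end Draws

/-! ### Admissibility of empirical distributions -/

section Empirical

variable {α : Type*} [MeasurableSpace α] {n : ℕ}

lemma integral_empirical [MeasurableSingletonClass α] (x : Fin n → α) (f : α → ℝ) :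
    ∫ y, f y ∂(empirical x) = (∑ j, f (x j)) / n := by
  rw [empirical, integral_smul_measure, integral_finsetSum_measure]
  · simp [div_eq_inv_mul]
  · exact fun j _ => integrable_dirac (by simp)

lemma empirical_mem_admissible [TopologicalSpace α] {F : Measure α} (hn : 0 < n) {x : Fin n → α}
    (hx : ∀ j, x j ∈ F.support) : empirical x ∈ admissible F := by
  have hn' : (n : ℝ≥0) ≠ 0 := by positivity
  refine ⟨n, 0, fun _ => (n : ℝ≥0)⁻¹, x, hx, ?_, ?_⟩
  · simp [hn']
  · rw [empirical, zero_smul, zero_add, ← Finset.smul_sum, ENNReal.smul_def, ENNReal.coe_inv hn']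
    simp

lemma self_mem_admissible [TopologicalSpace α] (F : Measure α) : F ∈ admissible F :=
  ⟨0, 1, fun _ => 0, fun k => k.elim0, fun k => k.elim0, by simp, by simp⟩

end Empirical


/-! ### The error of the algorithm given the data -/

section GivenData

variable {ι : Type*} {𝒳 : ι → Type*}
  [∀ i, MeasurableSpace (𝒳 i)]
  {ψ : (∀ i, Measure (𝒳 i)) → ℝ}
  {law : (∀ i, Measure (𝒳 i)) → Measure ℝ} {g : (∀ i, Measure (𝒳 i)) → ∀ i, 𝒳 i → ℝ}
  {n s : ι → ℕ} {x : ∀ i, Fin (n i) → 𝒳 i}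

/-- The value `E_*[(ε*)⁴]` when all models are resampled. -/
noncomputable def remainderMoment [Fintype ι] (ψ : (∀ i, Measure (𝒳 i)) → ℝ)
    (g : (∀ i, Measure (𝒳 i)) → ∀ i, 𝒳 i → ℝ) {n : ι → ℕ} (s : ι → ℕ)
    (x : ∀ i, Fin (n i) → 𝒳 i) : ℝ :=
  ∫ J : Draw n s, remainder ψ g (empiricals x) (empiricals (resample x J)) ^ 4 ∂(drawLaw n s)

/-- The value `E_*[μ₄]` when all models are resampled. -/
noncomputable def simulationMoment (ψ : (∀ i, Measure (𝒳 i)) → ℝ)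
    (law : (∀ i, Measure (𝒳 i)) → Measure ℝ) {n : ι → ℕ} (s : ι → ℕ)
    (x : ∀ i, Fin (n i) → 𝒳 i) : ℝ≥0∞ :=
  ∫⁻ J : Draw n s, mu4 ψ law (empiricals (resample x J)) ∂(drawLaw n s)

/-- The `p`-th moment of the `i`-th empirical influence function under the empirical
distribution. -/
noncomputable def influenceMoment (g : (∀ i, Measure (𝒳 i)) → ∀ i, 𝒳 i → ℝ) {n : ι → ℕ}
    (x : ∀ i, Fin (n i) → 𝒳 i) (p : ℕ) (i : ι) : ℝ :=
  (∑ j, g (empiricals x) i (x i j) ^ p) / n i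

lemma remainderMoment_nonneg [Fintype ι] : 0 ≤ remainderMoment ψ g s x :=
  integral_nonneg fun _ => by positivity

variable [∀ i, TopologicalSpace (𝒳 i)] {F : ∀ i, Measure (𝒳 i)}

lemma empiricals_mem_admissible (hn : ∀ i, 0 < n i) (hx : ∀ i j, x i j ∈ (F i).support) (i : ι) :
    empiricals x i ∈ admissible (F i) :=
  empirical_mem_admissible (hn i) (hx i)

/-- The normalisation of influence functions, read at the empirical distributions; it centres the
terms of `drawMean`. -/
lemma sum_influence_eq_zero [Fintype ι] [∀ i, MeasurableSingletonClass (𝒳 i)]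
    (hdiff : FirstOrderDifferentiable F ψ g) (hn : ∀ i, 0 < n i)
    (hx : ∀ i j, x i j ∈ (F i).support) (i : ι) : ∑ j, g (empiricals x) i (x i j) = 0 := by
  have h := (hdiff _ (empiricals_mem_admissible hn hx)).2.1 i
  have hn' : (n i : ℝ) ≠ 0 := by have := hn i; positivity
  rw [empiricals, integral_empirical, div_eq_zero_iff] at h
  exact h.resolve_right hn'

/-- True by definition of the remainder; this is the form that the moment bounds for draws take as
input. -/
lemma resampled_expansion [Fintype ι] [∀ i, MeasurableSingletonClass (𝒳 i)]
    (hdiff : FirstOrderDifferentiable F ψ g) (hn : ∀ i, 0 < n i)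
    (hx : ∀ i j, x i j ∈ (F i).support) (J : Draw n s) :
    ψ (empiricals (resample x J)) = ψ (empiricals x)
      + drawMean (fun i j => g (empiricals x) i (x i j)) J
      + remainder ψ g (empiricals x) (empiricals (resample x J)) := by
  have h : ∀ i, ∫ y, g (empiricals x) i y ∂(empiricals (resample x J) i)
      - ∫ y, g (empiricals x) i y ∂(empiricals x i)
      = (∑ l, g (empiricals x) i (x i (J i l))) / s i := fun i => by
    rw [(hdiff _ (empiricals_mem_admissible hn hx)).2.1 i, sub_zero]
    exact integral_empirical _ _
  simp_rw [remainder, h, drawMean]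
  ring

lemma memLp_replication (hsim : Simulable F ψ law) {P : ∀ i, Measure (𝒳 i)}
    (hP : ∀ i, P i ∈ admissible (F i)) (hm : mu4 ψ law P ≠ ∞) :
    MemLp (fun y : ℝ => y - ψ P) 4 (law P) ∧ ∫ y, (y - ψ P) ∂(law P) = 0 ∧
      ∫ y, (y - ψ P) ^ 4 ∂(law P) = (mu4 ψ law P).toReal := by
  obtain ⟨hprob, hint, hmean⟩ := hsim P hP
  refine ⟨?_, ?_, ?_⟩
  · rw [memLp_four_iff (by fun_prop)]
    refine ⟨by fun_prop, ?_⟩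
    rw [hasFiniteIntegral_iff_ofReal (ae_of_all _ fun y => by positivity)]
    exact lt_top_iff_ne_top.2 hm
  · rw [integral_sub hint (integrable_const _), hmean]; simp
  · rw [integral_eq_lintegral_of_nonneg_ae (ae_of_all _ fun y => by positivity) (by fun_prop)]
    rfl

/-- The relative error of the algorithm given the data. -/
lemma svbLaw_le [Fintype ι] [∀ i, MeasurableSingletonClass (𝒳 i)] (hsim : Simulable F ψ law)
    (hdiff : FirstOrderDifferentiable F ψ g) (hn : ∀ i, 0 < n i) {θ : ℝ}
    (hs : ∀ i, 0 < subSize θ n i) (hx : ∀ i j, x i j ∈ (F i).support)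
    (hM : simulationMoment ψ law (subSize θ n) x ≠ ∞) {B R : ℕ} (hB : 2 ≤ B) (hR : 2 ≤ R)
    {σ ε : ℝ} (hσ : 0 < σ) (hε : 0 < ε) :
    ∃ v Q : ℝ,
      |v - ∑ i, influenceMoment g x 2 i / subSize θ n i|
        ≤ √(remainderMoment ψ g (subSize θ n) x)
          + 2 * √((∑ i, influenceMoment g x 2 i / subSize θ n i)
            * √(remainderMoment ψ g (subSize θ n) x)) ∧
      0 ≤ Q ∧ Q ≤ 8 * (3 * (Fintype.card ι : ℝ) ^ 3
          * ∑ i, influenceMoment g x 4 i / subSize θ n i ^ 2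
        + remainderMoment ψ g (subSize θ n) x) ∧
      svbLaw law θ B R x {v | ε ≤ |v / σ - 1|} ≤ ENNReal.ofReal
        ((2 * θ ^ 2 * (5120 * Q / B
          + 15368 * (simulationMoment ψ law (subSize θ n) x).toReal / (B * R ^ 2))
        + 2 * (θ * v - σ) ^ 2) / (ε * σ) ^ 2) := by
  classical
  have hν := isProbabilityMeasure_drawLaw (s := subSize θ n) hn
  have hadm (J : Draw n (subSize θ n)) (i : ι) :
      empiricals (resample x J) i ∈ admissible (F i) :=
    empirical_mem_admissible (hs i) fun l => hx i _
  have hprob (J : Draw n (subSize θ n)) : IsProbabilityMeasure (law (empiricals (resample x J))) :=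
    (hsim _ (hadm J)).1
  have hfin (J : Draw n (subSize θ n)) : mu4 ψ law (empiricals (resample x J)) ≠ ∞ := fun hJ => by
    refine hM ?_
    rw [simulationMoment, lintegral_fintype, ENNReal.sum_eq_top]
    exact ⟨J, Finset.mem_univ _, by rw [hJ]; exact ENNReal.top_mul (drawLaw_singleton_ne_zero J)⟩
  have hrep (J : Draw n (subSize θ n)) := memLp_replication hsim (hadm J) (hfin J)
  have ha := sum_influence_eq_zero hdiff hn hx
  have hexp := resampled_expansion (s := subSize θ n) hdiff hn hx
  -- Unification supplies v = Var_*[ψ(F̂*)] and Q = E_*[(ψ(F̂*) − ψ(F̂))⁴].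
  refine ⟨_, _, abs_variance_draw_sub_le hn hs ha hexp, integral_nonneg fun J => by positivity,
    integral_draw_sub_pow_four_le hn hs ha hexp, ?_⟩
  have h := map_svbEstimate_le (ν := drawLaw n (subSize θ n)) (B := B)
    (fun J => (hrep J).1) (fun J => (hrep J).2.1) hB hR θ (ψ (empiricals x)) hσ hε
  simp_rw [fun J => (hrep J).2.2] at h
  rw [integral_toReal Measurable.of_discrete.aemeasurable
    (ae_of_all _ fun J => lt_top_iff_ne_top.2 (hfin J))] at h
  exact h

/-- The domination required by `tendsto_lintegral_of_inProb`. -/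
lemma svbLaw_le_one [Fintype ι] [∀ i, MeasurableSingletonClass (𝒳 i)] (hsim : Simulable F ψ law)
    (hn : ∀ i, 0 < n i) {θ : ℝ} (hs : ∀ i, 0 < subSize θ n i)
    (hx : ∀ i j, x i j ∈ (F i).support) (B R : ℕ) (S : Set ℝ) : svbLaw law θ B R x S ≤ 1 := by
  classical
  have hν := isProbabilityMeasure_drawLaw (s := subSize θ n) hn
  have hprob (J : Draw n (subSize θ n)) : IsProbabilityMeasure (law (empiricals (resample x J))) :=
    (hsim _ fun i => empirical_mem_admissible (hs i) fun l => hx i _).1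
  have h : IsProbabilityMeasure ((Measure.pi fun _ : Fin B => groupLaw (drawLaw n (subSize θ n))
      (fun J => law (empiricals (resample x J))) R).map (svbEstimate θ)) :=
    Measure.isProbabilityMeasure_map (measurable_svbEstimate θ).aemeasurable
  exact h.measure_univ ▸ measure_mono (Set.subset_univ S)

end GivenData

/-! ### Measurability and exchangeability of the data -/

section Data

variable {ι Ω : Type*} {𝒳 : ι → Type*} [MeasurableSpace Ω]
  {μ : Measure Ω}

/-- Replacing κ by a Dirac mass wherever it is not a probability measure yields a Markov kernel that
agrees with κ almost everywhere. -/
lemma aemeasurable_integral_of_ae_probability {κ : Ω → Measure ℝ} (hκ : Measurable κ)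
    (h1 : ∀ᵐ ω ∂μ, IsProbabilityMeasure (κ ω)) :
    AEMeasurable (fun ω => ∫ y, y ∂(κ ω)) μ := by
  classical
  set S : Set Ω := {ω | κ ω Set.univ = 1} with hS
  have hSm : MeasurableSet S := by
    have : Measurable fun ω => κ ω Set.univ := (Measure.measurable_coe .univ).comp hκ
    exact this (measurableSet_singleton 1)
  let η : Kernel Ω ℝ := ⟨fun ω => if ω ∈ S then κ ω else Measure.dirac 0,
    Measurable.ite hSm hκ measurable_const⟩
  have hη : IsMarkovKernel η := ⟨fun ω => by
    change IsProbabilityMeasure (if ω ∈ S then κ ω else Measure.dirac 0)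
    split_ifs with h
    · exact ⟨h⟩
    · infer_instance⟩
  have hm : Measurable fun ω => ∫ y, y ∂(η ω) :=
    (stronglyMeasurable_id.integral_kernel (κ := η)).measurable
  refine ⟨_, hm, ?_⟩
  filter_upwards [h1] with ω hω
  have : ω ∈ S := hω.measure_univ
  change _ = ∫ y, y ∂(if ω ∈ S then κ ω else Measure.dirac 0)
  rw [if_pos this]

variable [∀ i, TopologicalSpace (𝒳 i)] [∀ i, PolishSpace (𝒳 i)]
  [∀ i, MeasurableSpace (𝒳 i)]
  {F : ∀ i, Measure (𝒳 i)} {X : ∀ i, ℕ → Ω → 𝒳 i}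

/-- On a Polish space the support has full mass, so almost surely every empirical distribution of a
nonempty sample is admissible. -/
lemma ae_mem_support [Countable ι] (hX : ∀ i j, Measurable (X i j))
    (hlaw : ∀ i j, μ.map (X i j) = F i) :
    ∀ᵐ ω ∂μ, ∀ i j, X i j ω ∈ (F i).support := by
  rw [ae_all_iff]; intro i
  rw [ae_all_iff]; intro j
  refine ae_of_ae_map (hX i j).aemeasurable ?_
  rw [hlaw]
  exact Measure.support_mem_ae

omit [∀ i, TopologicalSpace (𝒳 i)] [∀ i, PolishSpace (𝒳 i)] in
lemma measurable_sample (hX : ∀ i j, Measurable (X i j)) (n : ι → ℕ) : Measurable (sample X n) :=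
  measurable_pi_lambda _ fun i => measurable_pi_lambda _ fun j => hX i j

omit [∀ i, PolishSpace (𝒳 i)] in
-- Measurability of ψ along the data is inherited from the simulation law, whose mean it is.
lemma aemeasurable_performance {ψ : (∀ i, Measure (𝒳 i)) → ℝ}
    {law : (∀ i, Measure (𝒳 i)) → Measure ℝ} {g : (∀ i, Measure (𝒳 i)) → ∀ i, 𝒳 i → ℝ}
    (hX : ∀ i j, Measurable (X i j)) (hsupp : ∀ᵐ ω ∂μ, ∀ i j, X i j ω ∈ (F i).support)
    (hsim : Simulable F ψ law) (hmeas : MeasurableInSample law g) {n : ι → ℕ}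
    (hn : ∀ i, 0 < n i) : AEMeasurable (fun ω => ψ (empiricals (sample X n ω))) μ := by
  have h : ∀ᵐ ω ∂μ, IsProbabilityMeasure (law (empiricals (sample X n ω))) ∧
      ∫ y, y ∂(law (empiricals (sample X n ω))) = ψ (empiricals (sample X n ω)) := by
    filter_upwards [hsupp] with ω hω
    obtain ⟨h1, -, h2⟩ := hsim (empiricals (sample X n ω))
      fun i => empirical_mem_admissible (hn i) fun j => hω i j
    exact ⟨h1, h2⟩
  refine (aemeasurable_integral_of_ae_probability ((hmeas n).1.comp (measurable_sample hX n))
    (h.mono fun ω hω => hω.1)).congr (h.mono fun ω hω => hω.2)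

end Data


/-! ### Permuting observations, and the law of large numbers -/

section Exchangeability

variable {ι Ω : Type*} {𝒳 : ι → Type*} [MeasurableSpace Ω] {μ : Measure Ω}
  [IsProbabilityMeasure μ] [∀ i, MeasurableSpace (𝒳 i)]
  {F : ∀ i, Measure (𝒳 i)} {X : ∀ i, ℕ → Ω → 𝒳 i}

/-- The law of the data is invariant under permutations of each sample. -/
lemma identDistrib_permuted_sample [Fintype ι] (hX : ∀ i j, Measurable (X i j))
    (hlaw : ∀ i j, μ.map (X i j) = F i)
    (hindep : iIndepFun (fun (p : Σ _ : ι, ℕ) => X p.1 p.2) μ) (n : ι → ℕ)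
    (σ : ∀ i, Equiv.Perm (Fin (n i))) :
    IdentDistrib (fun ω i (j : Fin (n i)) => X i (σ i j) ω) (sample X n) μ μ := by
  -- Independence survives an injective reindexing, so the joint law is the same product measure for
  -- every permutation.
  have key : ∀ τ : ∀ i, Equiv.Perm (Fin (n i)),
      μ.map (fun ω (p : Σ i, Fin (n i)) => X p.1 (τ p.1 p.2) ω)
        = Measure.pi fun p : Σ i, Fin (n i) => F p.1 := by
    intro τ
    have hinj : Function.Injective
        (fun p : Σ i, Fin (n i) => (⟨p.1, τ p.1 p.2⟩ : Σ _ : ι, ℕ)) := by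
      rintro ⟨i, j⟩ ⟨i', j'⟩ h
      simp only [Sigma.mk.injEq, heq_eq_eq] at h
      obtain ⟨rfl, h⟩ := h
      rw [Fin.val_inj, (τ i).injective.eq_iff] at h
      rw [h]
    have h := hindep.precomp hinj
    rw [iIndepFun_iff_map_fun_eq_pi_map fun p => (hX _ _).aemeasurable] at h
    refine h.trans ?_
    congr 1; ext1 p
    exact hlaw _ _
  have hcurry : Measurable (fun (x : ∀ p : Σ i, Fin (n i), 𝒳 p.1) i (j : Fin (n i)) => x ⟨i, j⟩) :=
    measurable_pi_lambda _ fun i => measurable_pi_lambda _ fun j => measurable_pi_apply _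
  have hm : ∀ τ : ∀ i, Equiv.Perm (Fin (n i)),
      Measurable (fun ω (p : Σ i, Fin (n i)) => X p.1 (τ p.1 p.2) ω) := fun τ =>
    measurable_pi_lambda _ fun p => hX _ _
  have hid : IdentDistrib (fun ω (p : Σ i, Fin (n i)) => X p.1 (σ p.1 p.2) ω)
      (fun ω (p : Σ i, Fin (n i)) => X p.1 ((1 : Equiv.Perm (Fin (n p.1))) p.2) ω) μ μ :=
    ⟨(hm σ).aemeasurable, (hm fun _ => 1).aemeasurable, (key σ).trans (key fun _ => 1).symm⟩
  exact hid.comp hcurry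

lemma empirical_perm {α : Type*} [MeasurableSpace α] {n : ℕ} (x : Fin n → α)
    (σ : Equiv.Perm (Fin n)) : empirical (fun j => x (σ j)) = empirical x := by
  unfold empirical
  rw [Equiv.sum_comp σ fun j => Measure.dirac (x j)]

variable {law : (∀ i, Measure (𝒳 i)) → Measure ℝ} {g : (∀ i, Measure (𝒳 i)) → ∀ i, 𝒳 i → ℝ}

omit [IsProbabilityMeasure μ] in
lemma aemeasurable_comp_data {i : ι} {f : 𝒳 i → ℝ} (hX : ∀ i j, Measurable (X i j))
    (hlaw : ∀ i j, μ.map (X i j) = F i) (hf : AEStronglyMeasurable f (F i)) (j : ℕ) :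
    AEMeasurable (fun ω => f (X i j ω)) μ := by
  refine AEMeasurable.comp_measurable ?_ (hX i j)
  rw [hlaw]
  exact hf.aemeasurable

omit [IsProbabilityMeasure μ] in
lemma aemeasurable_influence_sub (hX : ∀ i j, Measurable (X i j))
    (hlaw : ∀ i j, μ.map (X i j) = F i) (hmeas : MeasurableInSample law g) {i : ι} {f : 𝒳 i → ℝ}
    (hf : AEStronglyMeasurable f (F i)) {n : ι → ℕ} (j : Fin (n i)) :
    AEMeasurable (fun ω => (g (empiricals (sample X n ω)) i (X i j ω) - f (X i j ω)) ^ 4) μ :=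
  ((((hmeas n).2 i j).comp (measurable_sample hX n)).aemeasurable.sub
    (aemeasurable_comp_data hX hlaw hf j)).pow_const 4

/-- Exchangeability of the data. -/
lemma lintegral_influence_sub_eq [Fintype ι] (hX : ∀ i j, Measurable (X i j))
    (hlaw : ∀ i j, μ.map (X i j) = F i)
    (hindep : iIndepFun (fun (p : Σ _ : ι, ℕ) => X p.1 p.2) μ) (hmeas : MeasurableInSample law g)
    {i : ι} {f : 𝒳 i → ℝ} (hf : AEStronglyMeasurable f (F i)) {n : ι → ℕ} (j : Fin (n i)) :
    ∫⁻ ω, ENNReal.ofReal ((g (empiricals (sample X n ω)) i (X i j ω) - f (X i j ω)) ^ 4) ∂μ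
      = ∫⁻ ω, ENNReal.ofReal
          ((g (empiricals (sample X n ω)) i (X i 0 ω) - f (X i 0 ω)) ^ 4) ∂μ := by
  classical
  -- `f` is measurable only up to null sets, whereas invariance in law needs a genuinely measurable
  -- functional; hence the representative `h`.
  obtain ⟨h, hh, hfh⟩ := hf.aemeasurable
  have hae : ∀ k, ∀ᵐ ω ∂μ, f (X i k ω) = h (X i k ω) := fun k =>
    ae_of_ae_map (hX i k).aemeasurable (by rw [hlaw]; exact hfh)
  have e1 : ∀ k : ℕ,
      ∫⁻ ω, ENNReal.ofReal ((g (empiricals (sample X n ω)) i (X i k ω) - f (X i k ω)) ^ 4) ∂μ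
      = ∫⁻ ω, ENNReal.ofReal
        ((g (empiricals (sample X n ω)) i (X i k ω) - h (X i k ω)) ^ 4) ∂μ := fun k =>
    lintegral_congr_ae ((hae k).mono fun ω hω => by simp only [hω])
  rw [e1, e1]
  let z : Fin (n i) := ⟨0, j.pos⟩
  -- Swapping observations 0 and `j` of the `i`-th sample leaves the empirical distributions
  -- unchanged.
  let σ : ∀ i, Equiv.Perm (Fin (n i)) := Function.update (fun _ => 1) i (Equiv.swap z j)
  have hσ : σ i z = j := by simp [σ]
  have hΦ : Measurable fun x : ∀ i, Fin (n i) → 𝒳 i =>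
      ENNReal.ofReal ((g (empiricals x) i (x i z) - h (x i z)) ^ 4) :=
    ((((hmeas n).2 i z).sub (hh.comp ((measurable_pi_apply z).comp
      (measurable_pi_apply i)))).pow_const 4).ennreal_ofReal
  have hid := ((identDistrib_permuted_sample hX hlaw hindep n σ).comp hΦ).lintegral_eq
  refine Eq.trans ?_ hid
  refine lintegral_congr fun ω => ?_
  have h1 : empiricals (fun i (j : Fin (n i)) => X i (σ i j) ω) = empiricals (sample X n ω) :=
    funext fun i => empirical_perm (sample X n ω i) (σ i)
  simp only [Function.comp_apply, h1, hσ]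

/-- The empirical influence functions converge in mean of order four on the sample. -/
lemma tendsto_influence_sub [Fintype ι] (hX : ∀ i j, Measurable (X i j))
    (hlaw : ∀ i j, μ.map (X i j) = F i)
    (hindep : iIndepFun (fun (p : Σ _ : ι, ℕ) => X p.1 p.2) μ) (hmeas : MeasurableInSample law g)
    {i : ι} {f : 𝒳 i → ℝ} (hf : AEStronglyMeasurable f (F i)) {n : ℕ → ι → ℕ}
    (hn : ∀ᶠ k in atTop, 0 < n k i)
    (h : Tendsto (fun k => ∫⁻ ω, ENNReal.ofReal
      ((g (empiricals (sample X (n k) ω)) i (X i 0 ω) - f (X i 0 ω)) ^ 4) ∂μ) atTop (𝓝 0)) :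
    Tendsto (fun q : ℕ × Ω => (∑ j : Fin (n q.1 i), (g (empiricals (sample X (n q.1) q.2)) i
      (X i j q.2) - f (X i j q.2)) ^ 4) / n q.1 i) (inProb μ) (𝓝 0) := by
  refine tendsto_inProb_of_lintegral (f := fun k ω => (∑ j : Fin (n k i),
    (g (empiricals (sample X (n k) ω)) i (X i j ω) - f (X i j ω)) ^ 4) / n k i)
    (Eventually.of_forall fun k => ?_) (h.congr' ?_) fun k ω => by positivity
  · exact (Finset.aemeasurable_fun_sum _ fun j _ =>
      aemeasurable_influence_sub hX hlaw hmeas hf j).div_const _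
  · filter_upwards [hn] with k hk
    have hk' : (0 : ℝ) < n k i := by positivity
    have e : ∀ ω, ENNReal.ofReal ((∑ j : Fin (n k i),
        (g (empiricals (sample X (n k) ω)) i (X i j ω) - f (X i j ω)) ^ 4) / n k i)
        = (∑ j : Fin (n k i), ENNReal.ofReal
          ((g (empiricals (sample X (n k) ω)) i (X i j ω) - f (X i j ω)) ^ 4)) / n k i := fun ω => by
      rw [ENNReal.ofReal_div_of_pos hk', ENNReal.ofReal_sum_of_nonneg fun j _ => by positivity,
        ENNReal.ofReal_natCast]
    simp_rw [e, div_eq_mul_inv]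
    rw [lintegral_mul_const' _ _ (by simp [hk.ne']), lintegral_finsetSum' _ fun j _ =>
      (aemeasurable_influence_sub hX hlaw hmeas hf j).ennreal_ofReal]
    simp_rw [lintegral_influence_sub_eq hX hlaw hindep hmeas hf]
    simp only [Finset.sum_const, Finset.card_univ, Fintype.card_fin, nsmul_eq_mul]
    rw [mul_comm, ← mul_assoc, ENNReal.inv_mul_cancel (by simpa using hk.ne') (by simp), one_mul]

/-- The law of large numbers along the data sizes. -/
lemma tendsto_sample_mean (hX : ∀ i j, Measurable (X i j))
    (hlaw : ∀ i j, μ.map (X i j) = F i)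
    (hindep : iIndepFun (fun (p : Σ _ : ι, ℕ) => X p.1 p.2) μ) {i : ι} {f : 𝒳 i → ℝ}
    (hf : Integrable f (F i)) {n : ℕ → ι → ℕ} (hn : Tendsto (fun k => n k i) atTop atTop) :
    Tendsto (fun q : ℕ × Ω => (∑ j : Fin (n q.1 i), f (X i j q.2)) / n q.1 i) (inProb μ)
      (𝓝 (∫ x, f x ∂(F i))) := by
  rw [tendsto_inProb_iff (f := fun k ω => (∑ j : Fin (n k i), f (X i j ω)) / n k i)]
  refine tendstoInMeasure_of_tendsto_ae (fun k => ?_) ?_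
  · exact ((Finset.aemeasurable_fun_sum Finset.univ fun (j : Fin (n k i)) _ =>
      aemeasurable_comp_data hX hlaw hf.1 (j : ℕ)).div_const (n k i : ℝ)).aestronglyMeasurable
  obtain ⟨h, hh, hfh⟩ := hf.1.aemeasurable
  have hae : ∀ᵐ ω ∂μ, ∀ k, f (X i k ω) = h (X i k ω) := ae_all_iff.2 fun k =>
    ae_of_ae_map (hX i k).aemeasurable (by rw [hlaw]; exact hfh)
  have hint : Integrable h (μ.map (X i 0)) := by rw [hlaw]; exact hf.congr hfh
  have hlln := strong_law_ae_real (μ := μ) (fun j ω => h (X i j ω))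
    ((integrable_map_measure hint.1 (hX i 0).aemeasurable).1 hint)
    (fun j j' hjj' => (hindep.indepFun (i := ⟨i, j⟩) (j := ⟨i, j'⟩)
      (by simpa using hjj')).comp hh hh)
    (fun j => IdentDistrib.comp (f := X i j) (g := X i 0)
      ⟨(hX i j).aemeasurable, (hX i 0).aemeasurable, by rw [hlaw, hlaw]⟩ hh)
  have hm : ∫ ω, h (X i 0 ω) ∂μ = ∫ x, f x ∂(F i) := by
    rw [← integral_map (hX i 0).aemeasurable hint.1, hlaw]
    exact integral_congr_ae hfh.symm
  filter_upwards [hae, hlln] with ω h1 h2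
  rw [hm] at h2
  -- All samples are initial segments of one infinite sequence, so the almost sure limit passes to
  -- any sizes tending to infinity, monotone or not.
  refine (h2.comp hn).congr fun k => ?_
  simp only [Function.comp_apply, h1]
  rw [Finset.sum_range]

end Exchangeability

/-! ### Empirical moments of the influence functions -/

section EmpiricalMoments

/-- From a² − b² = (a − b)² + 2b(a − b) and Cauchy–Schwarz on both terms. Only `b` appears in the
bound besides the difference, so `a` may be the uncontrolled empirical influence function. -/
lemma abs_mean_sq_sub_le {n : ℕ} (hn : 0 < n) (a b : Fin n → ℝ) :
    |(∑ j, a j ^ 2) / n - (∑ j, b j ^ 2) / n|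
      ≤ √((∑ j, (a j - b j) ^ 4) / n)
        + 2 * √((∑ j, b j ^ 2) / n * √((∑ j, (a j - b j) ^ 4) / n)) := by
  have hn' : (0 : ℝ) < n := by positivity
  have h1 : (∑ j, (a j - b j) ^ 2) / n ≤ √((∑ j, (a j - b j) ^ 4) / n) := by
    apply Real.le_sqrt_of_sq_le
    rw [div_pow, div_le_div_iff₀ (by positivity) hn']
    have : (∑ j, (a j - b j) ^ 2) ^ 2 ≤ n * ∑ j, ((a j - b j) ^ 2) ^ 2 := by
      simpa using sq_sum_le_card_mul_sum_sq (s := Finset.univ) (f := fun j => (a j - b j) ^ 2)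
    have e : ∀ j, ((a j - b j) ^ 2) ^ 2 = (a j - b j) ^ 4 := fun j => by ring
    simp_rw [e] at this
    nlinarith
  have h2 : |(∑ j, b j * (a j - b j)) / n|
      ≤ √((∑ j, b j ^ 2) / n * √((∑ j, (a j - b j) ^ 4) / n)) := by
    apply Real.abs_le_sqrt
    refine le_trans ?_ (mul_le_mul_of_nonneg_left h1 (by positivity))
    rw [div_pow, div_mul_div_comm, ← sq]
    gcongr
    exact Finset.sum_mul_sq_le_sq_mul_sq _ _ _
  have h3 : (∑ j, a j ^ 2) / n - (∑ j, b j ^ 2) / (n : ℝ)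
      = (∑ j, (a j - b j) ^ 2) / n + 2 * ((∑ j, b j * (a j - b j)) / n) := by
    rw [← sub_div, ← mul_div_assoc, ← add_div, ← Finset.sum_sub_distrib, Finset.mul_sum,
      ← Finset.sum_add_distrib]
    congr 1
    exact Finset.sum_congr rfl fun j _ => by ring
  have h4 : 0 ≤ (∑ j, (a j - b j) ^ 2) / (n : ℝ) := by positivity
  rw [h3, abs_le]
  rw [abs_le] at h2
  constructor <;> linarith [h2.1, h2.2]

lemma mean_pow_four_le {n : ℕ} (a b : Fin n → ℝ) :
    (∑ j, a j ^ 4) / n ≤ 8 * ((∑ j, (a j - b j) ^ 4) / n + (∑ j, b j ^ 4) / n) := by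
  rw [← add_div, ← Finset.sum_add_distrib, ← mul_div_assoc, Finset.mul_sum]
  gcongr with j
  simpa using add_pow_four_le (a j - b j) (b j)

variable {ι Ω : Type*} [Fintype ι] {𝒳 : ι → Type*} [MeasurableSpace Ω] {μ : Measure Ω}
  [IsProbabilityMeasure μ] [∀ i, MeasurableSpace (𝒳 i)]
  {F : ∀ i, Measure (𝒳 i)} [∀ i, IsProbabilityMeasure (F i)] {X : ∀ i, ℕ → Ω → 𝒳 i}
  {law : (∀ i, Measure (𝒳 i)) → Measure ℝ} {g : (∀ i, Measure (𝒳 i)) → ∀ i, 𝒳 i → ℝ}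

lemma tendsto_influenceMoment_two (hX : ∀ i j, Measurable (X i j))
    (hlaw : ∀ i j, μ.map (X i j) = F i)
    (hindep : iIndepFun (fun (p : Σ _ : ι, ℕ) => X p.1 p.2) μ) (hmeas : MeasurableInSample law g)
    {i : ι} (hf : MemLp (g F i) 4 (F i)) {n : ℕ → ι → ℕ}
    (hn : Tendsto (fun k => n k i) atTop atTop)
    (h : Tendsto (fun k => ∫⁻ ω, ENNReal.ofReal
      ((g (empiricals (sample X (n k) ω)) i (X i 0 ω) - g F i (X i 0 ω)) ^ 4) ∂μ) atTop (𝓝 0)) :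
    Tendsto (fun q : ℕ × Ω => influenceMoment g (sample X (n q.1) q.2) 2 i) (inProb μ)
      (𝓝 (∫ x, g F i x ^ 2 ∂(F i))) := by
  have hn0 : ∀ᶠ k in atTop, 0 < n k i := hn.eventually_gt_atTop 0
  have hd := tendsto_influence_sub hX hlaw hindep hmeas hf.1 hn0 h
  have hl := tendsto_sample_mean hX hlaw hindep (integrable_sq_of_four hf) hn
  have hb := hd.sqrt.add ((hl.mul hd.sqrt).sqrt.const_mul 2)
  simp only [Real.sqrt_zero, mul_zero, add_zero] at hb
  have hdiff : Tendsto (fun q : ℕ × Ω => influenceMoment g (sample X (n q.1) q.2) 2 i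
      - (∑ j : Fin (n q.1 i), g F i (X i j q.2) ^ 2) / n q.1 i) (inProb μ) (𝓝 0) := by
    refine squeeze_zero_norm' ?_ hb
    filter_upwards [tendsto_fst_inProb.eventually hn0] with q hq
    exact abs_mean_sq_sub_le hq _ _
  simpa using hdiff.add hl

omit [∀ i, IsProbabilityMeasure (F i)] in
lemma exists_influenceMoment_four_le (hX : ∀ i j, Measurable (X i j))
    (hlaw : ∀ i j, μ.map (X i j) = F i)
    (hindep : iIndepFun (fun (p : Σ _ : ι, ℕ) => X p.1 p.2) μ) (hmeas : MeasurableInSample law g)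
    {i : ι} (hf : MemLp (g F i) 4 (F i)) {n : ℕ → ι → ℕ}
    (hn : Tendsto (fun k => n k i) atTop atTop)
    (h : Tendsto (fun k => ∫⁻ ω, ENNReal.ofReal
      ((g (empiricals (sample X (n k) ω)) i (X i 0 ω) - g F i (X i 0 ω)) ^ 4) ∂μ) atTop (𝓝 0)) :
    ∃ C : ℝ, ∀ᶠ q in inProb μ, influenceMoment g (sample X (n q.1) q.2) 4 i ≤ C := by
  have hn0 : ∀ᶠ k in atTop, 0 < n k i := hn.eventually_gt_atTop 0
  have hd := tendsto_influence_sub hX hlaw hindep hmeas hf.1 hn0 h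
  have hl := tendsto_sample_mean hX hlaw hindep (integrable_pow_four hf) hn
  have hb := (hd.add hl).const_mul 8
  refine ⟨_, (hb.eventually_le_const (lt_add_one _)).mono fun q hq => le_trans ?_ hq⟩
  exact mean_pow_four_le _ _

end EmpiricalMoments


/-! ### The input variance -/

section InputVarianceAsymptotics

variable {ι Ω : Type*} [Fintype ι] {𝒳 : ι → Type*} [MeasurableSpace Ω] {μ : Measure Ω}
  [∀ i, MeasurableSpace (𝒳 i)]
  {F : ∀ i, Measure (𝒳 i)} {X : ∀ i, ℕ → Ω → 𝒳 i}

/-- The variance of a sum of sample means. -/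
lemma variance_sum_sample_means (hX : ∀ i j, Measurable (X i j))
    (hlaw : ∀ i j, μ.map (X i j) = F i)
    (hindep : iIndepFun (fun (p : Σ _ : ι, ℕ) => X p.1 p.2) μ) {f : ∀ i, 𝒳 i → ℝ}
    (hf : ∀ i, MemLp (f i) 2 (F i)) {n : ι → ℕ} (hn : ∀ i, 0 < n i) :
    MemLp (fun ω => ∑ i, (∑ j : Fin (n i), f i (X i j ω)) / n i) 2 μ ∧
    Var[fun ω => ∑ i, (∑ j : Fin (n i), f i (X i j ω)) / n i; μ]
      = ∑ i, Var[f i; F i] / n i := by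
  classical
  choose h hh hfh using fun i => (hf i).1.aemeasurable
  have hhL : ∀ i, MemLp (h i) 2 (F i) := fun i => (hf i).ae_eq (hfh i)
  have hae : ∀ᵐ ω ∂μ, ∀ i j, f i (X i j ω) = h i (X i j ω) := ae_all_iff.2 fun i =>
    ae_all_iff.2 fun j => ae_of_ae_map (hX i j).aemeasurable (by rw [hlaw]; exact hfh i)
  let Z : (Σ i, Fin (n i)) → Ω → ℝ := fun p ω => (n p.1 : ℝ)⁻¹ * h p.1 (X p.1 p.2 ω)
  have hcomp : ∀ i j, MemLp (fun ω => h i (X i j ω)) 2 μ := fun i j =>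
    (hhL i).comp_measurePreserving ⟨hX i j, hlaw i j⟩
  have hZ : ∀ p, MemLp (Z p) 2 μ := fun p => (hcomp p.1 p.2).const_mul _
  have he : (fun ω => ∑ i, (∑ j : Fin (n i), f i (X i j ω)) / n i) =ᵐ[μ] ∑ p, Z p := by
    filter_upwards [hae] with ω hω
    rw [Finset.sum_apply, Fintype.sum_sigma]
    refine Finset.sum_congr rfl fun i _ => ?_
    rw [div_eq_inv_mul, Finset.mul_sum]
    exact Finset.sum_congr rfl fun j _ => by rw [hω]
  refine ⟨(memLp_finsetSum' Finset.univ fun p _ => hZ p).ae_eq he.symm, ?_⟩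
  rw [variance_congr he, IndepFun.variance_sum fun p _ => hZ p, Fintype.sum_sigma]
  · refine Finset.sum_congr rfl fun i _ => ?_
    have hn' : (n i : ℝ) ≠ 0 := by have := hn i; positivity
    have hv : ∀ j : Fin (n i), Var[Z ⟨i, j⟩; μ] = ((n i : ℝ)⁻¹) ^ 2 * Var[f i; F i] := fun j => by
      rw [variance_const_mul, variance_congr (hfh i),
        ← (show MeasurePreserving (X i j) μ (F i) from ⟨hX i j, hlaw i j⟩).variance_fun_comp
          (hh i).aemeasurable]
    simp only [hv, Finset.sum_const, Finset.card_univ, Fintype.card_fin, nsmul_eq_mul]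
    field_simp
  · intro p _ q _ hpq
    have hne : (⟨p.1, p.2⟩ : Σ _ : ι, ℕ) ≠ ⟨q.1, q.2⟩ := by
      rintro h
      obtain ⟨i, j⟩ := p
      obtain ⟨i', j'⟩ := q
      simp only [Sigma.mk.injEq, heq_eq_eq] at h
      obtain ⟨rfl, h⟩ := h
      exact hpq (by rw [Fin.val_inj.1 h])
    exact (hindep.indepFun hne).comp ((hh p.1).const_mul _) ((hh q.1).const_mul _)

variable [∀ i, TopologicalSpace (𝒳 i)]
  {ψ : (∀ i, Measure (𝒳 i)) → ℝ} {law : (∀ i, Measure (𝒳 i)) → Measure ℝ}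
  {g : (∀ i, Measure (𝒳 i)) → ∀ i, 𝒳 i → ℝ}

/-- The first order approximation of the input variance. -/
lemma tendsto_inputVar_sub [IsProbabilityMeasure μ] [∀ i, MeasurableSingletonClass (𝒳 i)]
    [∀ i, IsProbabilityMeasure (F i)] (hX : ∀ i j, Measurable (X i j))
    (hlaw : ∀ i j, μ.map (X i j) = F i)
    (hindep : iIndepFun (fun (p : Σ _ : ι, ℕ) => X p.1 p.2) μ)
    (hsupp : ∀ᵐ ω ∂μ, ∀ i j, X i j ω ∈ (F i).support)
    (hsim : Simulable F ψ law) (hmeas : MeasurableInSample law g) {n : ℕ → ι → ℕ}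
    (hdiff : FirstOrderDifferentiable F ψ g) (htruth : SmoothAtTruth μ X F ψ g n)
    (hn : ∀ᶠ k in atTop, ∀ i, 0 < n k i) {c : ℝ}
    (hc : ∀ᶠ k in atTop, 0 < avg (n k) ∧ ∀ i, avg (n k) / n k i ≤ c) :
    Tendsto (fun k => avg (n k) * inputVar μ X ψ (n k)
      - ∑ i, Var[g F i; F i] * (avg (n k) / n k i)) atTop (𝓝 0) := by
  set ε : ℕ → Ω → ℝ := fun k ω => remainder ψ g F (empiricals (sample X (n k) ω)) with hε
  set E : ℕ → ℝ≥0∞ := fun k => ∫⁻ ω, ENNReal.ofReal (ε k ω ^ 2) ∂μ with hE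
  set V : ℝ := ∑ i, Var[g F i; F i] * c with hV
  have hg2 : ∀ i, MemLp (g F i) 2 (F i) := fun i => memLp_two_of_four (htruth.2 i).2
  have h0 : Tendsto (fun k => avg (n k) * (E k).toReal) atTop (𝓝 0) := by
    have := (ENNReal.tendsto_toReal ENNReal.zero_ne_top).comp htruth.1
    refine this.congr' ?_
    filter_upwards [hc] with k hk
    simp only [Function.comp_apply, ENNReal.toReal_mul]
    rw [ENNReal.toReal_ofReal hk.1.le]
  -- A positive multiple of an infinite value could not tend to zero.
  have hfin : ∀ᶠ k in atTop, E k ≠ ∞ := by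
    filter_upwards [htruth.1.eventually_lt_const (zero_lt_one' ℝ≥0∞), hc] with k hk hk' htop
    change ENNReal.ofReal (avg (n k)) * E k < 1 at hk
    rw [htop, ENNReal.mul_top (by simpa using hk'.1)] at hk
    exact absurd hk (by simp)
  have hb := h0.add ((h0.const_mul V).sqrt.const_mul 2)
  simp only [mul_zero, Real.sqrt_zero, add_zero] at hb
  refine squeeze_zero_norm' ?_ hb
  filter_upwards [hn, hc, hfin] with k hnk hck hfk
  obtain ⟨hL, hVL⟩ := variance_sum_sample_means hX hlaw hindep hg2 hnk
  set L : Ω → ℝ := fun ω => ∑ i, (∑ j : Fin (n k i), g F i (X i j ω)) / n k i with hLdef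
  have hexp : ∀ ω, ψ (empiricals (sample X (n k) ω)) = ψ F + (L ω + ε k ω) := fun ω => by
    have h1 : ∀ i, ∫ y, g F i y ∂(empiricals (sample X (n k) ω) i) - ∫ y, g F i y ∂(F i)
        = (∑ j : Fin (n k i), g F i (X i j ω)) / n k i := fun i => by
      rw [(hdiff F fun i => self_mem_admissible (F i)).2.1 i, sub_zero]
      exact integral_empirical _ _
    simp only [hε, remainder, h1, hLdef]
    ring
  have hψ := aemeasurable_performance hX hsupp hsim hmeas hnk
  -- The assumption bounds only a lower integral of ε²; measurability comes from ε being ψ minus a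
  -- constant and the linear term.
  have hεm : AEStronglyMeasurable (ε k) μ := by
    have : ε k = fun ω => ψ (empiricals (sample X (n k) ω)) - ψ F - L ω := by
      ext ω; rw [hexp]; ring
    rw [this]
    exact ((hψ.sub_const _).sub hL.1.aemeasurable).aestronglyMeasurable
  have hεi : Integrable (fun ω => ε k ω ^ 2) μ := by
    refine ⟨hεm.pow 2, ?_⟩
    rw [hasFiniteIntegral_iff_ofReal (ae_of_all _ fun ω => sq_nonneg _)]
    exact lt_top_iff_ne_top.2 hfk
  have hε2 : MemLp (ε k) 2 μ := (memLp_two_iff_integrable_sq hεm).2 hεi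
  have hεE : ∫ ω, ε k ω ^ 2 ∂μ = (E k).toReal :=
    integral_eq_lintegral_of_nonneg_ae (ae_of_all _ fun ω => sq_nonneg _) hεi.1
  have hvar : inputVar μ X ψ (n k) = Var[fun ω => L ω + ε k ω; μ] := by
    rw [inputVar, ← variance_const_add (X := fun ω => L ω + ε k ω) (hL.1.add hεm) (ψ F)]
    simp_rw [hexp]
  have hmain := abs_variance_add_sub_le hL hε2
  rw [← hvar, hVL, hεE] at hmain
  have hN := hck.1
  have h2 : ∑ i, Var[g F i; F i] * (avg (n k) / n k i)
      = avg (n k) * ∑ i, Var[g F i; F i] / n k i := by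
    rw [Finset.mul_sum]; exact Finset.sum_congr rfl fun i _ => by ring
  have h3 : avg (n k) * ∑ i, Var[g F i; F i] / n k i ≤ V := by
    rw [← h2]
    exact Finset.sum_le_sum fun i _ => mul_le_mul_of_nonneg_left (hck.2 i) (variance_nonneg _ _)
  rw [h2, ← mul_sub, Real.norm_eq_abs, abs_mul, abs_of_pos hN]
  calc avg (n k) * |inputVar μ X ψ (n k) - ∑ i, Var[g F i; F i] / n k i|
      ≤ avg (n k) * ((E k).toReal + 2 * √((∑ i, Var[g F i; F i] / n k i) * (E k).toReal)) := by
        gcongr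
    _ = avg (n k) * (E k).toReal + 2 * √((avg (n k) * ∑ i, Var[g F i; F i] / n k i)
          * (avg (n k) * (E k).toReal)) := by
        have : (avg (n k) * ∑ i, Var[g F i; F i] / n k i) * (avg (n k) * (E k).toReal)
          = avg (n k) ^ 2 * ((∑ i, Var[g F i; F i] / n k i) * (E k).toReal) := by ring
        rw [this, Real.sqrt_mul (sq_nonneg _), Real.sqrt_sq hN.le]
        ring
    _ ≤ _ := by gcongr

end InputVarianceAsymptotics

/-! ### Allocation of the simulation budget -/

section Allocation

/-- R is the geometric mean of N and a, rounded down, and B is N/R, rounded down. Then R/N ≈ √(a/N)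
→ 0, which gives both B → ∞ and BR/N → 1, while BR²/a² ≈ NR/a² ≈ (N/a)^{3/2} → ∞. -/
lemma exists_allocation {a : ℕ → ℝ} {N : ℕ → ℕ} (hN : Tendsto N atTop atTop)
    (ha : Tendsto a atTop atTop) (haN : Tendsto (fun k => a k / N k) atTop (𝓝 0)) :
    ∃ B R : ℕ → ℕ, (∀ k, 2 ≤ B k ∧ 2 ≤ R k) ∧ (∀ᶠ k in atTop, B k * R k ≤ N k) ∧
      Tendsto (fun k => ((B k * R k : ℕ) : ℝ) / N k) atTop (𝓝 1) ∧
      Tendsto B atTop atTop ∧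
      Tendsto (fun k => (B k : ℝ) * (R k : ℝ) ^ 2 / a k ^ 2) atTop atTop := by
  have hNr : Tendsto (fun k => (N k : ℝ)) atTop atTop := tendsto_natCast_atTop_atTop.comp hN
  set t : ℕ → ℝ := fun k => √(N k * a k) with ht
  set r : ℕ → ℕ := fun k => ⌊t k⌋₊ with hr
  have hpos : ∀ᶠ k in atTop, 0 < a k ∧ (0 : ℝ) < N k :=
    (ha.eventually_gt_atTop 0).and (hNr.eventually_gt_atTop 0)
  have htt : Tendsto t atTop atTop :=
    Real.tendsto_sqrt_atTop.comp (hNr.atTop_mul_atTop₀ ha)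
  have hrt : Tendsto r atTop atTop := tendsto_nat_floor_atTop.comp htt
  have htN : Tendsto (fun k => t k / N k) atTop (𝓝 0) := by
    have := haN.sqrt
    rw [Real.sqrt_zero] at this
    refine this.congr' ?_
    filter_upwards [hpos] with k hk
    rw [ht, eq_div_iff hk.2.ne', ← Real.sqrt_sq hk.2.le,
      ← Real.sqrt_mul (div_nonneg hk.1.le (by positivity)),
      Real.sqrt_sq hk.2.le]
    congr 1
    have := hk.2.ne'
    field_simp
  have hle : ∀ k, (r k : ℝ) ≤ t k := fun k => Nat.floor_le (Real.sqrt_nonneg _)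
  have hrN : Tendsto (fun k => (r k : ℝ) / N k) atTop (𝓝 0) :=
    squeeze_zero (fun k => by positivity) (fun k => by gcongr; exact hle k) htN
  have hr2 : ∀ᶠ k in atTop, 2 ≤ r k := hrt.eventually_ge_atTop 2
  have hbig : Tendsto (fun k => N k / r k) atTop atTop := by
    rw [tendsto_atTop]
    intro M
    have h1 : ∀ᶠ k in atTop, (r k : ℝ) / N k < 1 / (M + 1) :=
      hrN.eventually_lt_const (by positivity)
    filter_upwards [h1, hr2, hpos] with k hk h2 hp
    rw [Nat.le_div_iff_mul_le (by omega)]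
    rw [div_lt_div_iff₀ hp.2 (by positivity)] at hk
    have : (r k : ℝ) * (M + 1) < N k := by simpa using hk
    have : (M : ℝ) * r k ≤ N k := by nlinarith [(r k).cast_nonneg (α := ℝ)]
    exact_mod_cast this
  have hB2 : ∀ᶠ k in atTop, 2 ≤ N k / r k := hbig.eventually_ge_atTop 2
  have hlow : ∀ᶠ k in atTop, (1 : ℝ) - r k / N k ≤ ((N k / r k * r k : ℕ) : ℝ) / N k := by
    filter_upwards [hr2, hpos] with k h2 hp
    have h3 : N k < N k / r k * r k + r k := by
      have := Nat.div_add_mod (N k) (r k)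
      have := Nat.mod_lt (N k) (show r k > 0 by omega)
      rw [mul_comm]; omega
    have h4 : (N k : ℝ) ≤ (N k / r k * r k : ℕ) + r k := by exact_mod_cast h3.le
    rw [sub_le_iff_le_add, ← add_div, le_div_iff₀ hp.2, one_mul]
    exact h4
  have hmul : ∀ k, N k / r k * r k ≤ N k := fun k => Nat.div_mul_le_self _ _
  have hratio : Tendsto (fun k => ((N k / r k * r k : ℕ) : ℝ) / N k) atTop (𝓝 1) := by
    refine tendsto_of_tendsto_of_tendsto_of_le_of_le' (g := fun k => 1 - (r k : ℝ) / N k)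
      (by simpa using hrN.const_sub 1) tendsto_const_nhds hlow ?_
    filter_upwards [hpos] with k hp
    rw [div_le_one hp.2]
    exact_mod_cast hmul k
  -- The maximum with 2 secures the size constraint for all `k` and is eventually inactive.
  have heq : ∀ᶠ k in atTop, max 2 (N k / r k) = N k / r k ∧ max 2 (r k) = r k := by
    filter_upwards [hr2, hB2] with k h1 h2
    exact ⟨max_eq_right h2, max_eq_right h1⟩
  refine ⟨fun k => max 2 (N k / r k), fun k => max 2 (r k),
    fun k => ⟨le_max_left _ _, le_max_left _ _⟩, ?_, ?_, ?_, ?_⟩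
  · filter_upwards [heq] with k hk
    rw [hk.1, hk.2]
    exact hmul k
  · refine hratio.congr' ?_
    filter_upwards [heq] with k hk
    rw [hk.1, hk.2]
  · refine hbig.congr' ?_
    filter_upwards [heq] with k hk
    rw [hk.1]
  · have hlim : Tendsto (fun k => √(N k / a k)) atTop atTop := by
      refine Real.tendsto_sqrt_atTop.comp ?_
      have h1 : Tendsto (fun k => a k / N k) atTop (𝓝[>] 0) :=
        tendsto_nhdsWithin_iff.2 ⟨haN, hpos.mono fun k hk => div_pos hk.1 hk.2⟩
      exact h1.inv_tendsto_nhdsGT_zero.congr fun k => inv_div _ _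
    -- The weaker lower bound √(N/a)/4 suffices: BR² ≥ (N/2)(t/2) ≥ (a/2)(t/2), and t = √(N/a) a.
    refine tendsto_atTop_mono' _ ?_ (hlim.const_mul_atTop (show (0 : ℝ) < 1 / 4 by norm_num))
    have hhalf : ∀ᶠ k in atTop, (1 : ℝ) / 2 ≤ ((N k / r k * r k : ℕ) : ℝ) / N k :=
      hratio.eventually_const_le (by norm_num)
    filter_upwards [heq, hpos, hhalf, htt.eventually_ge_atTop 2, ha.eventually_ge_atTop 1,
      haN.eventually_le_const one_pos] with k hk hp hh h2 ha1 haN1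
    rw [hk.1, hk.2]
    have hf : t k / 2 ≤ r k := by
      have := Nat.lt_floor_add_one (t k)
      have : t k < r k + 1 := this
      linarith
    have hBR : (N k : ℝ) / 2 ≤ (N k / r k : ℕ) * r k := by
      rw [le_div_iff₀ hp.2] at hh
      push_cast at hh ⊢
      linarith
    have hNa : (a k : ℝ) ≤ N k := by rwa [div_le_one hp.2] at haN1
    have ht2 : t k = √(N k / a k) * a k := by
      rw [ht, ← Real.sqrt_sq hp.1.le, ← Real.sqrt_mul (by positivity), Real.sqrt_sq hp.1.le]
      have := hp.1.ne'
      field_simp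
    rw [le_div_iff₀ (by have := hp.1; positivity)]
    calc 1 / 4 * √(N k / a k) * a k ^ 2 = (a k / 2) * (t k / 2) := by rw [ht2]; ring
      _ ≤ (N k / 2) * (t k / 2) := by gcongr
      _ ≤ ((N k / r k : ℕ) * r k) * r k := by gcongr
      _ = _ := by ring

end Allocation


/-! ### Data sizes and subsample sizes -/

section Sizes

variable {ι : Type*} [Fintype ι] [Nonempty ι] {n : ℕ → ι → ℕ} {θ : ℕ → ℝ}

lemma BalancedData.exists_bounds (hbal : BalancedData n) :
    ∃ c : ℝ, 0 < c ∧ ∀ᶠ k in atTop, (∀ i, 0 < n k i) ∧ 0 < avg (n k) ∧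
      ∀ i, avg (n k) / n k i ≤ c ∧ 1 / c ≤ avg (n k) / n k i := by
  obtain ⟨hn, c, hc, hcn⟩ := hbal
  refine ⟨c, hc, ?_⟩
  have hpos : ∀ᶠ k in atTop, ∀ i, 0 < n k i :=
    eventually_all.2 fun i => (hn i).eventually_gt_atTop 0
  have hcard : (0 : ℝ) < Fintype.card ι := by exact_mod_cast Fintype.card_pos
  filter_upwards [hpos, hcn] with k hk hck
  have hk' : ∀ i, (0 : ℝ) < n k i := fun i => by exact_mod_cast hk i
  refine ⟨hk, div_pos (Finset.sum_pos (fun i _ => hk' i) Finset.univ_nonempty) hcard,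
    fun i => ⟨?_, ?_⟩⟩
  · rw [avg, div_le_iff₀ (hk' i), div_le_iff₀ hcard]
    calc ∑ j, (n k j : ℝ) ≤ ∑ _j : ι, c * n k i := Finset.sum_le_sum fun j _ => hck j i
      _ = _ := by simp; ring
  · rw [avg, div_le_div_iff₀ hc (hk' i), one_mul, div_mul_eq_mul_div, le_div_iff₀ hcard]
    calc (n k i : ℝ) * Fintype.card ι = ∑ _j : ι, (n k i : ℝ) := by simp; ring
      _ ≤ ∑ j, c * n k j := Finset.sum_le_sum fun j _ => hck i j
      _ = _ := by rw [Finset.sum_mul]; exact Finset.sum_congr rfl fun j _ => mul_comm _ _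

omit [Nonempty ι] in
lemma tendsto_subSize {c : ℝ} (hc : 0 < c) (hθ : ∀ k, 0 < θ k)
    (hlow : Tendsto (fun k => θ k * avg (n k)) atTop atTop)
    (hn : ∀ᶠ k in atTop, (∀ i, 0 < n k i) ∧ 0 < avg (n k) ∧
      ∀ i, avg (n k) / n k i ≤ c ∧ 1 / c ≤ avg (n k) / n k i) (i : ι) :
    Tendsto (fun k => subSize (θ k) (n k) i) atTop atTop := by
  refine tendsto_nat_floor_atTop.comp ?_
  refine tendsto_atTop_mono' _ ?_ (hlow.atTop_div_const hc)
  filter_upwards [hn] with k hk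
  have h1 : (0 : ℝ) < n k i := by exact_mod_cast hk.1 i
  have h2 := (hk.2.2 i).1
  rw [div_le_iff₀ h1] at h2
  rw [div_le_iff₀ hc]
  have := mul_le_mul_of_nonneg_left h2 (hθ k).le
  linarith

lemma subSize_bounds {c : ℝ} (hc : 0 < c) (hθ : ∀ k, 0 < θ k)
    (hlow : Tendsto (fun k => θ k * avg (n k)) atTop atTop)
    (hn : ∀ᶠ k in atTop, (∀ i, 0 < n k i) ∧ 0 < avg (n k) ∧
      ∀ i, avg (n k) / n k i ≤ c ∧ 1 / c ≤ avg (n k) / n k i) :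
    ∀ᶠ k in atTop, (∀ i, 0 < subSize (θ k) (n k) i ∧
      θ k * avg (n k) / subSize (θ k) (n k) i ≤ 2 * c) ∧
      θ k * avg (n k) ≤ 2 * c * avg (subSize (θ k) (n k)) := by
  have hs : ∀ᶠ k in atTop, ∀ i, 0 < subSize (θ k) (n k) i :=
    eventually_all.2 fun i => (tendsto_subSize hc hθ hlow hn i).eventually_gt_atTop 0
  filter_upwards [hs, hn] with k hsk hnk
  have h1 : ∀ i, θ k * avg (n k) ≤ 2 * c * subSize (θ k) (n k) i := fun i => by
    have h2 : (0 : ℝ) < n k i := by exact_mod_cast hnk.1 i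
    have h3 := (hnk.2.2 i).1
    rw [div_le_iff₀ h2] at h3
    have h4 : θ k * n k i < subSize (θ k) (n k) i + 1 := Nat.lt_floor_add_one _
    -- Source of the factor 2: θ nᵢ < sᵢ + 1 ≤ 2 sᵢ.
    have h5 : (1 : ℝ) ≤ subSize (θ k) (n k) i := by exact_mod_cast hsk i
    calc θ k * avg (n k) ≤ θ k * (c * n k i) := mul_le_mul_of_nonneg_left h3 (hθ k).le
      _ = c * (θ k * n k i) := by ring
      _ ≤ c * (2 * subSize (θ k) (n k) i) :=
          mul_le_mul_of_nonneg_left (by linarith) hc.le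
      _ = _ := by ring
  refine ⟨fun i => ⟨hsk i, ?_⟩, ?_⟩
  · rw [div_le_iff₀ (by exact_mod_cast hsk i)]
    exact h1 i
  · have hcard : (0 : ℝ) < Fintype.card ι := by exact_mod_cast Fintype.card_pos
    rw [avg.eq_def (subSize _ _), ← mul_div_assoc, Finset.mul_sum, le_div_iff₀ hcard]
    calc _ = ∑ _i : ι, θ k * avg (n k) := by simp [mul_comm]
      _ ≤ _ := Finset.sum_le_sum fun i _ => h1 i

omit [Nonempty ι] in
-- Rounding moves θ nᵢ by less than 1, a relative error below 1/sᵢ. This aligns the weights of the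
-- bootstrap variance with those of the input variance.
lemma tendsto_subSize_ratio {c : ℝ} (hc : 0 < c) (hθ : ∀ k, 0 < θ k)
    (hlow : Tendsto (fun k => θ k * avg (n k)) atTop atTop)
    (hn : ∀ᶠ k in atTop, (∀ i, 0 < n k i) ∧ 0 < avg (n k) ∧
      ∀ i, avg (n k) / n k i ≤ c ∧ 1 / c ≤ avg (n k) / n k i) (i : ι) :
    Tendsto (fun k => θ k * avg (n k) / subSize (θ k) (n k) i - avg (n k) / n k i) atTop
      (𝓝 0) := by
  have hs := tendsto_subSize hc hθ hlow hn i
  have hs' : Tendsto (fun k => (subSize (θ k) (n k) i : ℝ)) atTop atTop :=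
    tendsto_natCast_atTop_atTop.comp hs
  refine squeeze_zero_norm' ?_ (hs'.const_div_atTop c)
  filter_upwards [hs.eventually_gt_atTop 0, hn] with k hsk hnk
  have h2 : (0 : ℝ) < n k i := by exact_mod_cast hnk.1 i
  have h3 : (0 : ℝ) < subSize (θ k) (n k) i := by exact_mod_cast hsk
  have h4 : θ k * n k i < subSize (θ k) (n k) i + 1 := Nat.lt_floor_add_one _
  have h5 : subSize (θ k) (n k) i ≤ θ k * n k i :=
    Nat.floor_le (mul_nonneg (hθ k).le h2.le)
  have h6 : θ k * avg (n k) / subSize (θ k) (n k) i - avg (n k) / n k i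
      = (avg (n k) / n k i) * ((θ k * n k i - subSize (θ k) (n k) i) / subSize (θ k) (n k) i) := by
    field_simp
  have h7 : 0 ≤ avg (n k) / n k i := div_nonneg hnk.2.1.le h2.le
  rw [h6, Real.norm_eq_abs, abs_mul, abs_of_nonneg h7, abs_of_nonneg (div_nonneg (by linarith) h3.le),
    ← mul_one_div c]
  gcongr
  · exact (hnk.2.2 i).1
  · linarith

end Sizes

/-! ### Relative consistency -/

section Consistency

variable {ι Ω : Type*} [Fintype ι] [Nonempty ι] {𝒳 : ι → Type*}
  [∀ i, TopologicalSpace (𝒳 i)] [∀ i, PolishSpace (𝒳 i)]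
  [∀ i, MeasurableSpace (𝒳 i)] [∀ i, BorelSpace (𝒳 i)]
  [MeasurableSpace Ω] {μ : Measure Ω} [IsProbabilityMeasure μ]
  {F : ∀ i, Measure (𝒳 i)} [∀ i, IsProbabilityMeasure (F i)]
  {X : ∀ i, ℕ → Ω → 𝒳 i}
  {ψ : (∀ i, Measure (𝒳 i)) → ℝ} {law : (∀ i, Measure (𝒳 i)) → Measure ℝ}
  {g : (∀ i, Measure (𝒳 i)) → ∀ i, 𝒳 i → ℝ}

/-- Variances are rescaled by n, so that n σ_I² and a v = n (θ v) are compared at order one. Both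
are close to ∑ Var(gᵢ) n/nᵢ, and a lower bound on n σ_I² turns absolute errors into relative ones.
-/
theorem relativelyConsistent (hX : ∀ i j, Measurable (X i j))
    (hlaw : ∀ i j, μ.map (X i j) = F i)
    (hindep : iIndepFun (fun (p : Σ _ : ι, ℕ) => X p.1 p.2) μ)
    (hsim : Simulable F ψ law) (hmeas : MeasurableInSample law g)
    {n : ℕ → ι → ℕ} {θ : ℕ → ℝ} (hbal : BalancedData n)
    (hdiff : FirstOrderDifferentiable F ψ g) (htruth : SmoothAtTruth μ X F ψ g n)
    (hemp : SmoothAtEmpirical μ X F ψ g n θ) (hmom : FourthMomentBounded μ X ψ law n θ)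
    (hθ : ∀ k, 0 < θ k) {B R : ℕ → ℕ} (hBR : ∀ᶠ k in atTop, 2 ≤ B k ∧ 2 ≤ R k)
    (hcrit : Criterion n θ B R) : RelativelyConsistent μ X ψ law n θ B R := by
  obtain ⟨hB, hBR2, hlow⟩ := hcrit
  obtain ⟨c, hc, hn⟩ := hbal.exists_bounds
  have hsupp := ae_mem_support hX hlaw
  have hs := subSize_bounds hc hθ hlow hn
  set a : ℕ → ℝ := fun k => θ k * avg (n k) with ha
  set σ2 : ι → ℝ := fun i => Var[g F i; F i] with hσ2
  have hσ2pos : ∀ i, 0 < σ2 i := fun i => (htruth.2 i).1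
  -- the input variance
  have hinput := tendsto_inputVar_sub hX hlaw hindep hsupp hsim hmeas hdiff htruth
    (hn.mono fun k hk => hk.1) (c := c) (hn.mono fun k hk => ⟨hk.2.1, fun i => (hk.2.2 i).1⟩)
  -- Half of a lower bound for the linear term; the other half absorbs the approximation error of n
  -- σ_I².
  set κ : ℝ := (∑ i, σ2 i * (1 / c)) / 2 with hκ
  have hκpos : 0 < κ :=
    half_pos (Finset.sum_pos (fun i _ => mul_pos (hσ2pos i) (by positivity)) Finset.univ_nonempty)
  have hinputpos : ∀ᶠ k in atTop, κ ≤ avg (n k) * inputVar μ X ψ (n k) := by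
    filter_upwards [hinput.eventually_const_le (show -κ < 0 by linarith), hn] with k hk hnk
    have : ∑ i, σ2 i * (1 / c) ≤ ∑ i, σ2 i * (avg (n k) / n k i) :=
      Finset.sum_le_sum fun i _ => mul_le_mul_of_nonneg_left (hnk.2.2 i).2 (hσ2pos i).le
    linarith
  -- empirical moments of the influence functions
  have hv : ∀ i, Tendsto (fun q : ℕ × Ω => influenceMoment g (sample X (n q.1) q.2) 2 i)
      (inProb μ) (𝓝 (σ2 i)) := fun i => by
    have h := tendsto_influenceMoment_two hX hlaw hindep hmeas (htruth.2 i).2 (hbal.1 i) (hemp.1 i)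
    rwa [← variance_of_integral_eq_zero (htruth.2 i).2.1.aemeasurable
      ((hdiff F fun i => self_mem_admissible (F i)).2.1 i)] at h
  choose C hC using fun i =>
    exists_influenceMoment_four_le hX hlaw hindep hmeas (htruth.2 i).2 (hbal.1 i) (hemp.1 i)
  -- the remainder
  set E : ℕ × Ω → ℝ := fun q => remainderMoment ψ g (subSize (θ q.1) (n q.1))
    (sample X (n q.1) q.2) with hE
  have hE0 : ∀ q, 0 ≤ E q := fun q => remainderMoment_nonneg
  have haE : Tendsto (fun q : ℕ × Ω => a q.1 ^ 2 * E q) (inProb μ) (𝓝 0) := by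
    -- The choice `fun _ => true` resamples every model; (2c)² comes from a ≤ 2c · avg s.
    have h := (tendsto_inProb_iff.2 (hemp.2 fun _ => true)).const_mul ((2 * c) ^ 2)
    rw [mul_zero] at h
    refine squeeze_zero' (Eventually.of_forall fun q => mul_nonneg (sq_nonneg _) (hE0 q)) ?_ h
    filter_upwards [tendsto_fst_inProb.eventually hs,
      tendsto_fst_inProb.eventually (hlow.eventually_ge_atTop 0)] with q hq hq0
    rw [← mul_assoc, ← mul_pow]
    exact mul_le_mul_of_nonneg_right (pow_le_pow_left₀ hq0 hq.2 2) (hE0 q)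
  -- the conditional variance of the linear term
  set W : ℕ × Ω → ℝ := fun q => ∑ i, influenceMoment g (sample X (n q.1) q.2) 2 i
    * (a q.1 / subSize (θ q.1) (n q.1) i) with hW
  have hWlim : Tendsto (fun q : ℕ × Ω => W q - ∑ i, σ2 i * (avg (n q.1) / n q.1 i)) (inProb μ)
      (𝓝 0) := by
    have h : ∀ i, Tendsto (fun q : ℕ × Ω => influenceMoment g (sample X (n q.1) q.2) 2 i
        * (a q.1 / subSize (θ q.1) (n q.1) i) - σ2 i * (avg (n q.1) / n q.1 i)) (inProb μ)
        (𝓝 0) := fun i => by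
      have h1 : Tendsto (fun q : ℕ × Ω => |influenceMoment g (sample X (n q.1) q.2) 2 i - σ2 i|
          * (2 * c) + σ2 i * |a q.1 / subSize (θ q.1) (n q.1) i - avg (n q.1) / n q.1 i|)
          (inProb μ) (𝓝 0) := by
        have h2 := ((hv i).sub_const (σ2 i)).abs.mul_const (2 * c)
        have h3 := (((tendsto_subSize_ratio hc hθ hlow hn i).comp
          (tendsto_fst_inProb (μ := μ))).abs).const_mul (σ2 i)
        simpa using h2.add h3
      refine squeeze_zero_norm' ?_ h1
      filter_upwards [tendsto_fst_inProb.eventually hs,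
        tendsto_fst_inProb.eventually (hlow.eventually_ge_atTop 0)] with q hq hq0
      have h4 : influenceMoment g (sample X (n q.1) q.2) 2 i * (a q.1 / subSize (θ q.1) (n q.1) i)
          - σ2 i * (avg (n q.1) / n q.1 i)
          = (influenceMoment g (sample X (n q.1) q.2) 2 i - σ2 i)
            * (a q.1 / subSize (θ q.1) (n q.1) i)
          + σ2 i * (a q.1 / subSize (θ q.1) (n q.1) i - avg (n q.1) / n q.1 i) := by ring
      have h5 : 0 ≤ a q.1 / subSize (θ q.1) (n q.1) i := div_nonneg hq0 (by positivity)
      rw [h4, Real.norm_eq_abs]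
      refine (abs_add_le _ _).trans ?_
      rw [abs_mul, abs_mul, abs_of_nonneg h5, abs_of_pos (hσ2pos i)]
      gcongr
      exact (hq.1 i).2
    have := tendsto_finsetSum Finset.univ fun i _ => h i
    simpa [hW, Finset.sum_sub_distrib] using this
  have hWdiff : Tendsto (fun q : ℕ × Ω => |W q - avg (n q.1) * inputVar μ X ψ (n q.1)|)
      (inProb μ) (𝓝 0) := by
    have := (hWlim.sub (hinput.comp (tendsto_fst_inProb (μ := μ)))).abs
    rw [sub_zero, abs_zero] at this
    exact this.congr fun q => congrArg abs (sub_sub_sub_cancel_right _ _ _)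
  set V : ℝ := ∑ i, (σ2 i + 1) * (2 * c) with hV
  have hWle : ∀ᶠ q in inProb μ, W q ≤ V := by
    have h : ∀ᶠ q in inProb μ, ∀ i,
        influenceMoment g (sample X (n q.1) q.2) 2 i ≤ σ2 i + 1 :=
      eventually_all.2 fun i => (hv i).eventually_le_const (lt_add_one _)
    filter_upwards [h, tendsto_fst_inProb.eventually hs,
      tendsto_fst_inProb.eventually (hlow.eventually_ge_atTop 0)] with q h1 hq hq0
    refine Finset.sum_le_sum fun i _ => mul_le_mul (h1 i) (hq.1 i).2
      (div_nonneg hq0 (by positivity)) (by linarith [hσ2pos i])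
  -- the error bound
  set K : ℝ := 3 * (Fintype.card ι : ℝ) ^ 3 * ∑ i, C i * (2 * c) ^ 2 with hK
  set M : ℕ → Ω → ℝ≥0∞ := fun k ω =>
    simulationMoment ψ law (subSize (θ k) (n k)) (sample X (n k) ω) with hM
  have hMfin : ∀ᶠ q in inProb μ, M q.1 q.2 ≠ ∞ := eventually_inProb_ne_top (hmom fun _ => true)
  have hMlim : Tendsto (fun q : ℕ × Ω => (a q.1 ^ 2 / (B q.1 * (R q.1 : ℝ) ^ 2))
      * (M q.1 q.2).toReal) (inProb μ) (𝓝 0) :=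
    tendsto_inProb_of_bounded (a := fun k => a k ^ 2 / (B k * (R k : ℝ) ^ 2))
      (hBR2.inv_tendsto_atTop.congr fun k => inv_div _ _) (hmom fun _ => true)
  have hBinv : Tendsto (fun q : ℕ × Ω => ((B q.1 : ℝ))⁻¹) (inProb μ) (𝓝 0) :=
    (tendsto_natCast_atTop_atTop.comp (hB.comp tendsto_fst_inProb)).inv_tendsto_atTop
  set Δ : ℕ × Ω → ℝ := fun q => √(a q.1 ^ 2 * E q) + 2 * √(V * √(a q.1 ^ 2 * E q))
    + |W q - avg (n q.1) * inputVar μ X ψ (n q.1)| with hΔ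
  have hΔlim : Tendsto Δ (inProb μ) (𝓝 0) := by
    have h := (haE.sqrt.add ((haE.sqrt.const_mul V).sqrt.const_mul 2)).add hWdiff
    simpa only [Real.sqrt_zero, mul_zero, add_zero] using h
  intro ε hε
  -- The Chebyshev bound after rescaling, with n σ_I² in the denominator replaced by its lower bound
  -- κ.
  have hbound : Tendsto (fun q : ℕ × Ω =>
      (2 * (5120 * (8 * (K + a q.1 ^ 2 * E q) * ((B q.1 : ℝ))⁻¹)
        + 15368 * ((a q.1 ^ 2 / (B q.1 * (R q.1 : ℝ) ^ 2)) * (M q.1 q.2).toReal))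
        + 2 * Δ q ^ 2) / (ε * κ) ^ 2) (inProb μ) (𝓝 0) := by
    have h1 := (((haE.const_add K).const_mul 8).mul hBinv).const_mul 5120
    have h2 := ((h1.add (hMlim.const_mul 15368)).const_mul 2).add ((hΔlim.pow 2).const_mul 2)
    have h3 := h2.div_const ((ε * κ) ^ 2)
    simpa using h3
  refine tendsto_lintegral_of_inProb (f := fun k ω => svbLaw law (θ k) (B k) (R k)
    (sample X (n k) ω) {v | ε ≤ |v / inputVar μ X ψ (n k) - 1|}) ?_ fun δ hδ => ?_
  · filter_upwards [hn, hs] with k hnk hsk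
    filter_upwards [hsupp] with ω hω
    exact svbLaw_le_one hsim hnk.1 (fun i => (hsk.1 i).1) (fun i j => hω i j) _ _ _
  have hsupp' : ∀ᶠ q in inProb μ, ∀ i j, X i j q.2 ∈ (F i).support :=
    eventually_inProb_of_ae (hsupp.mono fun ω hω _ => hω)
  filter_upwards [hbound.eventually_le_const hδ, hsupp', hMfin, hWle, eventually_all.2 hC,
    tendsto_fst_inProb.eventually (((hn.and hs).and hBR).and
      (hinputpos.and (hlow.eventually_ge_atTop 0)))] with q hq hsq hMq hWq hCq hk
  obtain ⟨⟨⟨hnq, hsubq⟩, hB2, hR2⟩, hκq, ha0⟩ := hk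
  have hσ : 0 < inputVar μ X ψ (n q.1) :=
    pos_of_mul_pos_right (hκpos.trans_le hκq) hnq.2.1.le
  obtain ⟨v, Q, h1, h2, h3, h4⟩ := svbLaw_le (x := sample X (n q.1) q.2) hsim hdiff hnq.1
    (fun i => (hsubq.1 i).1) (fun i j => hsq i j) hMq hB2 hR2 hσ hε
  refine h4.trans (ENNReal.ofReal_le_ofReal (le_trans ?_ hq))
  set A := avg (n q.1) with hA
  set σ := inputVar μ X ψ (n q.1) with hσdef
  have hA0 : 0 < A := hnq.2.1
  have hBpos : (0 : ℝ) < B q.1 := by positivity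
  have haQ : a q.1 ^ 2 * Q ≤ 8 * (K + a q.1 ^ 2 * E q) := by
    calc a q.1 ^ 2 * Q ≤ a q.1 ^ 2 * (8 * (3 * (Fintype.card ι : ℝ) ^ 3
          * ∑ i, influenceMoment g (sample X (n q.1) q.2) 4 i / subSize (θ q.1) (n q.1) i ^ 2
          + E q)) := by gcongr
      _ = 8 * (3 * (Fintype.card ι : ℝ) ^ 3
          * ∑ i, influenceMoment g (sample X (n q.1) q.2) 4 i
            * (a q.1 / subSize (θ q.1) (n q.1) i) ^ 2 + a q.1 ^ 2 * E q) := by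
          have : ∑ i, influenceMoment g (sample X (n q.1) q.2) 4 i
              * (a q.1 / subSize (θ q.1) (n q.1) i) ^ 2
              = a q.1 ^ 2 * ∑ i, influenceMoment g (sample X (n q.1) q.2) 4 i
                / subSize (θ q.1) (n q.1) i ^ 2 := by
            rw [Finset.mul_sum]
            exact Finset.sum_congr rfl fun i _ => by ring
          rw [this]; ring
      _ ≤ _ := by
          rw [hK]
          gcongr with i
          · have : 0 ≤ influenceMoment g (sample X (n q.1) q.2) 4 i := by
              unfold influenceMoment; positivity
            exact this.trans (hCq i)
          · exact hCq i
          · exact (hsubq.1 i).2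
  have hav : |a q.1 * v - A * σ| ≤ Δ q := by
    have h5 : |a q.1 * v - W q| ≤ √(a q.1 ^ 2 * E q) + 2 * √(V * √(a q.1 ^ 2 * E q)) := by
      have h6 : W q = a q.1 * ∑ i, influenceMoment g (sample X (n q.1) q.2) 2 i
          / subSize (θ q.1) (n q.1) i := by
        rw [Finset.mul_sum]
        exact Finset.sum_congr rfl fun i _ => by ring
      have h7 : √(a q.1 ^ 2 * E q) = a q.1 * √(E q) := by
        rw [Real.sqrt_mul (sq_nonneg _), Real.sqrt_sq ha0]
      calc |a q.1 * v - W q| = a q.1 * |v - ∑ i, influenceMoment g (sample X (n q.1) q.2) 2 i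
            / subSize (θ q.1) (n q.1) i| := by
            rw [h6, ← mul_sub, abs_mul, abs_of_nonneg ha0]
        _ ≤ a q.1 * (√(E q) + 2 * √((∑ i, influenceMoment g (sample X (n q.1) q.2) 2 i
            / subSize (θ q.1) (n q.1) i) * √(E q))) := by gcongr
        _ = √(a q.1 ^ 2 * E q) + 2 * √(W q * √(a q.1 ^ 2 * E q)) := by
            have h8 : W q * √(a q.1 ^ 2 * E q) = a q.1 ^ 2
                * ((∑ i, influenceMoment g (sample X (n q.1) q.2) 2 i
                  / subSize (θ q.1) (n q.1) i) * √(E q)) := by rw [h6, h7]; ring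
            rw [h8, h7, Real.sqrt_mul (sq_nonneg _), Real.sqrt_sq ha0]
            ring
        _ ≤ _ := by gcongr
    calc |a q.1 * v - A * σ| ≤ |a q.1 * v - W q| + |W q - A * σ| := abs_sub_le _ _ _
      _ ≤ Δ q := add_le_add h5 le_rfl
  -- Numerator and denominator are multiplied by n², which turns θ into a.
  have hscale : (2 * θ q.1 ^ 2 * (5120 * Q / B q.1
        + 15368 * (M q.1 q.2).toReal / (B q.1 * (R q.1 : ℝ) ^ 2))
        + 2 * (θ q.1 * v - σ) ^ 2) / (ε * σ) ^ 2
      = (2 * (5120 * (a q.1 ^ 2 * Q * ((B q.1 : ℝ))⁻¹)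
        + 15368 * ((a q.1 ^ 2 / (B q.1 * (R q.1 : ℝ) ^ 2)) * (M q.1 q.2).toReal))
        + 2 * (a q.1 * v - A * σ) ^ 2) / (ε * (A * σ)) ^ 2 := by
    have hRpos : (0 : ℝ) < R q.1 := by positivity
    simp only [ha, ← hA]
    field_simp
  change (2 * θ q.1 ^ 2 * (5120 * Q / B q.1
        + 15368 * (M q.1 q.2).toReal / (B q.1 * (R q.1 : ℝ) ^ 2))
        + 2 * (θ q.1 * v - σ) ^ 2) / (ε * σ) ^ 2 ≤ _
  rw [hscale]
  have hsq' : (a q.1 * v - A * σ) ^ 2 ≤ Δ q ^ 2 := by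
    rw [← sq_abs]; gcongr
  have hnum : 0 ≤ 8 * (K + a q.1 ^ 2 * E q) * ((B q.1 : ℝ))⁻¹ :=
    mul_nonneg (le_trans (by positivity) haQ) (by positivity)
  gcongr

end Consistency

end InputVariance

open InputVariance in
theorem theorem4 {ι Ω : Type*} [Fintype ι] [Nonempty ι] {𝒳 : ι → Type*}
    [∀ i, TopologicalSpace (𝒳 i)] [∀ i, PolishSpace (𝒳 i)]
    [∀ i, MeasurableSpace (𝒳 i)] [∀ i, BorelSpace (𝒳 i)]
    [MeasurableSpace Ω] (μ : Measure Ω) [IsProbabilityMeasure μ]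
    -- the true input distributions, and independent data from them
    (F : ∀ i, Measure (𝒳 i)) [∀ i, IsProbabilityMeasure (F i)]
    (X : ∀ i, ℕ → Ω → 𝒳 i) (hX : ∀ i j, Measurable (X i j))
    (hlaw : ∀ i j, μ.map (X i j) = F i)
    (hindep : iIndepFun (fun (p : Σ _ : ι, ℕ) => X p.1 p.2) μ)
    -- performance measure, law of a simulation replication, influence functions
    (ψ : (∀ i, Measure (𝒳 i)) → ℝ) (law : (∀ i, Measure (𝒳 i)) → Measure ℝ)
    (g : (∀ i, Measure (𝒳 i)) → ∀ i, 𝒳 i → ℝ)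
    (hsim : Simulable F ψ law) (hmeas : MeasurableInSample law g)
    -- data sizes, subsample ratio and total simulation budget
    (n : ℕ → ι → ℕ) (θ : ℕ → ℝ) (N : ℕ → ℕ)
    (hbal : BalancedData n)
    (hdiff : FirstOrderDifferentiable F ψ g)
    (htruth : SmoothAtTruth μ X F ψ g n)
    (hemp : SmoothAtEmpirical μ X F ψ g n θ)
    (hvar : EmpiricalVarianceConverges μ X F ψ law n)
    (hres : ResampledVarianceConverges μ X ψ law n θ)
    (hmom : FourthMomentBounded μ X ψ law n θ)
    (hN : Tendsto N atTop atTop)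
    (hθ : ∀ k, 0 < θ k ∧ θ k ≤ 1)
    (hθlow : Tendsto (fun k => θ k * avg (n k)) atTop atTop)
    (hθup : Tendsto (fun k => θ k * avg (n k) / N k) atTop (𝓝 0)) :
    (∃ B R : ℕ → ℕ, (∀ k, 2 ≤ B k ∧ 2 ≤ R k) ∧
      (∀ᶠ k in atTop, B k * R k ≤ N k) ∧
      Tendsto (fun k => ((B k * R k : ℕ) : ℝ) / N k) atTop (𝓝 1) ∧
      Criterion n θ B R) ∧
    (∀ B R : ℕ → ℕ, (∀ᶠ k in atTop, 2 ≤ B k ∧ 2 ≤ R k) → Criterion n θ B R →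
      RelativelyConsistent μ X ψ law n θ B R) := by
  refine ⟨?_, fun B R hBR hcrit => relativelyConsistent hX hlaw hindep hsim hmeas hbal hdiff
    htruth hemp hmom (fun k => (hθ k).1) hBR hcrit⟩
  obtain ⟨B, R, h2, hle, hlim, hB, hBR⟩ := exists_allocation hN hθlow hθup
  exact ⟨B, R, h2, hle, hlim, hB, hBR, hθlow⟩
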